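/- There is an absolute constant $\alpha_0>0$ such that for every $C\ge 1$ there are constants $c>0$ and $C'>0$, depending only on $C$, with the following property. Let $0<\alpha\le\alpha_0$, let $q$ be an odd prime power and let $n\ge 0$ be an integer. Let $F_1,\dots,F_n\subseteq\{1,\dots,n\}$ satisfy $|F_i|<\alpha n$ for all $i$, and $i\in F_j$ if and only if $j\in F_i$, for all $i,j$. Let $M_n$ be a random $n\times n$ matrix over $\mathbf{F}_q$ with zero diagonal and $M_n(j,i)=-M_n(i,j)$ for $i<j$, such that the entries $M_n(i,j)$ with $i<j$ and $j\notin F_i$ are mutually independent and near uniform, i.e. $\mathbf{P}(M_n(i,j)=a)\le C/q$ for all $a\in\mathbf{F}_q$, while the entries $M_n(i,j)$ with $i<j$ and $j\in F_i$ are arbitrary random variables whose family (with any joint law) is independent of the family of the former entries. Let $Q(M_n)=n-\operatorname{rank}(M_n)$, and let $Q_{alt,e}$ and $Q_{alt,o}$ be the random variables with $$\mathbf{P}(Q_{alt,e}=k)=\prod_{i=0}^\infty(1-q^{-2i-1})\,\frac{q^k}{\prod_{i=1}^k(q^i-1)}\ \text{ for even } k\ge 0,\qquad \mathbf{P}(Q_{alt,e}=k)=0\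 \text{ for odd } k,$$ $$\mathbf{P}(Q_{alt,o}=k)=\prod_{i=0}^\infty(1-q^{-2i-1})\,\frac{q^k}{\prod_{i=1}^k(q^i-1)}\ \text{ for odd } k\ge 1,\qquad \mathbf{P}(Q_{alt,o}=k)=0\ \text{ for even } k.$$ Write $\|X-Y\|_{TV}=\frac12\sum_{k\ge 0}|\mathbf{P}(X=k)-\mathbf{P}(Y=k)|$. Then $$\|Q(M_n)-Q_{alt,e}\|_{TV}\le\Big(\frac{C'}{q}\Big)^{cn}\ \text{ if } n \text{ is even},\qquad \|Q(M_n)-Q_{alt,o}\|_{TV}\le\Big(\frac{C'}{q}\Big)^{cn}\ \text{ if } n \text{ is odd}.$$ -/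

import Mathlib

open MeasureTheory ProbabilityTheory

noncomputable section

/-- The corank `n - rank A` of a square matrix (`rank A ≤ n`, so the subtraction is exact). -/
def corank {n : ℕ} {K : Type*} [Field K] (A : Matrix (Fin n) (Fin n) K) : ℕ :=
  n - A.rank

/-- The law of a random variable `X` with values in `ℕ`, as a mass function `k ↦ P(X = k)`. -/
def massFn {Ω : Type*} [MeasurableSpace Ω] (μ : Measure Ω) (X : Ω → ℕ) (k : ℕ) : ℝ :=
  μ.real {ω | X ω = k}

/-- The total variation distance of two mass functions on `ℕ`, `(1/2) ∑ₖ |p k - r k|`. -/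
def tvDist (p r : ℕ → ℝ) : ℝ :=
  (1 / 2) * ∑' k : ℕ, |p k - r k|

/-- The weight `∏_{i ≥ 0} (1 - q^{-2i-1}) * q^k / ∏_{i=1}^k (q^i - 1)`. -/
def altWeight (q k : ℕ) : ℝ :=
  (∏' i : ℕ, (1 - ((q : ℝ) ^ (2 * i + 1))⁻¹)) *
    ((q : ℝ) ^ k / ∏ i ∈ Finset.Icc 1 k, ((q : ℝ) ^ i - 1))

/-- The mass function of the limiting corank `Q_{alt,e}`. -/
def altEven (q k : ℕ) : ℝ :=
  if Even k then altWeight q k else 0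

/-- The mass function of the limiting corank `Q_{alt,o}`. -/
def altOdd (q k : ℕ) : ℝ :=
  if Odd k then altWeight q k else 0

/-- The condition on the index sets: each has fewer than `α n` elements, and
`i ∈ F j` if and only if `j ∈ F i`. -/
structure SmallSymmetric {n : ℕ} (α : ℝ) (F : Fin n → Finset (Fin n)) : Prop where
  card_lt : ∀ i, ((F i).card : ℝ) < α * n
  symm : ∀ i j, i ∈ F j ↔ j ∈ F i

/-- Positions above the diagonal that do not fall in the index sets. -/
abbrev FreePos {n : ℕ} (F : Fin n → Finset (Fin n)) : Type :=
  {p : Fin n × Fin n // p.1 < p.2 ∧ p.2 ∉ F p.1}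

/-- Positions above the diagonal that fall in the index sets. -/
abbrev ArbPos {n : ℕ} (F : Fin n → Finset (Fin n)) : Type :=
  {p : Fin n × Fin n // p.1 < p.2 ∧ p.2 ∈ F p.1}

/-- `M` is a random alternating matrix over the finite field `K` whose entries above the diagonal
and outside the index sets `F` are independent and near uniform with constant `C`. The entries
above the diagonal at positions in the index sets are arbitrary random variables, with an
arbitrary joint law, independent of all the other entries above the diagonal. -/
structure IsNearUniformAlternating {n : ℕ} {K Ω : Type*} [Field K] [Fintype K]
    [MeasurableSpace K] [MeasurableSpace Ω] (C : ℝ) (F : Fin n → Finset (Fin n))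
    (μ : Measure Ω) (M : Ω → Matrix (Fin n) (Fin n) K) : Prop where
  measurable : ∀ i j, Measurable fun ω => M ω i j
  diag : ∀ ω i, M ω i i = 0
  antisymm : ∀ ω i j, i < j → M ω j i = -M ω i j
  nearUniform : ∀ i j, i < j → j ∉ F i → ∀ a : K,
    μ.real {ω | M ω i j = a} ≤ C / Fintype.card K
  indep_free : iIndepFun (fun (p : FreePos F) (ω : Ω) => M ω p.1.1 p.1.2) μ
  indep_arb : IndepFun (fun (ω : Ω) (p : FreePos F) => M ω p.1.1 p.1.2)
    (fun (ω : Ω) (p : ArbPos F) => M ω p.1.1 p.1.2) μ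

/-- The infinite product in `altWeight` converges. -/
theorem altWeight_multipliable {q : ℕ} (hq : 2 ≤ q) :
    Multipliable fun i : ℕ => (1 - ((q : ℝ) ^ (2 * i + 1))⁻¹) := by
  have hq' : (2 : ℝ) ≤ q := by exact_mod_cast hq
  have hs : Summable fun i : ℕ => ((q : ℝ) ^ (2 * i + 1))⁻¹ := by
    have h1 : Summable fun i : ℕ => ((q : ℝ)⁻¹) ^ i :=
      summable_geometric_of_lt_one (by positivity) (inv_lt_one_of_one_lt₀ (by linarith))
    refine Summable.of_nonneg_of_le (fun i => by positivity) (fun i => ?_) h1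
    rw [inv_pow]
    exact inv_anti₀ (by positivity) (pow_le_pow_right₀ (by linarith) (by omega))
  simp only [sub_eq_add_neg]
  exact Real.multipliable_one_add_of_summable hs.neg

/-- The weights are summable, so total variation distances to `altEven` and `altOdd` are genuine
sums. -/
theorem altWeight_summable {q : ℕ} (hq : 2 ≤ q) : Summable (altWeight q) := by
  have hq' : (2 : ℝ) ≤ q := by exact_mod_cast hq
  have hpos : ∀ i : ℕ, 1 ≤ i → 0 < (q : ℝ) ^ i - 1 := fun i hi => by
    have : (1 : ℝ) < (q : ℝ) ^ i := one_lt_pow₀ (by linarith) (by omega)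
    linarith
  refine Summable.mul_left _ ?_
  refine summable_of_ratio_test_tendsto_lt_one (l := 0) one_pos
    (Filter.Eventually.of_forall fun k => ?_) ?_
  · exact div_ne_zero (by positivity)
      (Finset.prod_pos fun i hi => hpos i (Finset.mem_Icc.1 hi).1).ne'
  · have hratio : ∀ k : ℕ, ‖(q : ℝ) ^ (k + 1) / ∏ i ∈ Finset.Icc 1 (k + 1), ((q : ℝ) ^ i - 1)‖ /
        ‖(q : ℝ) ^ k / ∏ i ∈ Finset.Icc 1 k, ((q : ℝ) ^ i - 1)‖ =
        (q : ℝ) / ((q : ℝ) ^ (k + 1) - 1) := fun k => by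
      have hP : 0 < ∏ i ∈ Finset.Icc 1 k, ((q : ℝ) ^ i - 1) :=
        Finset.prod_pos fun i hi => hpos i (Finset.mem_Icc.1 hi).1
      have h1 := hpos (k + 1) (by omega)
      rw [Finset.prod_Icc_succ_top (by omega), Real.norm_of_nonneg (by positivity),
        Real.norm_of_nonneg (by positivity)]
      have : (q : ℝ) ≠ 0 := by positivity
      field_simp
      ring
    simp only [hratio]
    refine Filter.Tendsto.const_div_atTop ?_ _
    refine Filter.tendsto_atTop_add_const_right _ (-1 : ℝ) ?_
    exact (tendsto_pow_atTop_atTop_of_one_lt (by linarith)).comp (Filter.tendsto_add_atTop_nat 1)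

end

/-! Fix the values at the arbitrary positions. By independence, the law of the corank is a mixture
over these values (`massFn_corank_eq_sum`) of laws for matrices with independent entries, the fixed
ones having point masses as laws. The limit does not depend on the fixed values, so it suffices to
bound each component of the mixture.

Build such a matrix by adding one row and column at a time. Skew-symmetry forces the corank to rise
by one if the new column is orthogonal to the kernel and to drop by one otherwise; hence its parity
is that of the size. At corank `d` a uniform column gives a rise with probability exactly `q ^
(-d)`, so in the uniform case the corank is a Markov chain, with operator `chainStep`. For a
near-uniform column, Fourier analysis on the kernel gives the same probability up to `δ`, unless the
kernel contains a nonzero vector where the characteristic function of the column exceeds `δ`.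
Parseval's identity bounds the number of such vectors, each of them lies in the kernel with
exponentially small probability, and a union bound finishes the comparison (`stepError_le`).

The chain forgets its start quickly: signed measures of mass zero on one parity class shrink by the
factor `3 / √q` per step in a norm that weights `j ≥ 2` by `√q ^ j` (`IsBalanced.chainStep`). The
two limiting laws are exchanged by the chain because of detailed balance (`chainStep_altParity`),
and identities of Euler give their total mass (`hasSum_altParity`). Start at size about `n / 4`: the
initial norm is then overcome by the contraction over the other `3n / 4` steps, and each of these
steps has an exponentially small error (`tsum_abs_corankMass_sub_le_pow`). For `q` below a constant
power of `C` the claimed bound is at least one and there is nothing to prove. -/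

open scoped Matrix Topology

/-! ### Alternating matrices and the effect of one new row and column on the corank. -/

section LinearAlgebra

variable {K : Type*} [Field K]

/-- Alternating matrices: skew-symmetric with zero diagonal. -/
structure IsAlternating {ι : Type*} (m : Matrix ι ι K) : Prop where
  diag : ∀ i, m i i = 0
  skew : ∀ i j, m j i = -m i j

theorem IsAlternating.ext_of_lt {ι : Type*} [LinearOrder ι] {A B : Matrix ι ι K}
    (hA : IsAlternating A) (hB : IsAlternating B) (h : ∀ i j, i < j → A i j = B i j) : A = B := by
  ext i j
  rcases lt_trichotomy i j with hij | rfl | hij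
  · exact h i j hij
  · rw [hA.diag, hB.diag]
  · rw [hA.skew j i, hB.skew j i, h j i hij]

theorem IsAlternating.dotProduct_mulVec {ι : Type*} [Fintype ι] {m : Matrix ι ι K}
    (hm : IsAlternating m) (u w : ι → K) : u ⬝ᵥ (m *ᵥ w) = -(w ⬝ᵥ (m *ᵥ u)) := by
  have ht : mᵀ = -m := by ext i j; simp [hm.skew i j]
  rw [Matrix.dotProduct_mulVec, ← Matrix.mulVec_transpose, ht, Matrix.neg_mulVec,
    neg_dotProduct, dotProduct_comm]

/-- The terms at `(i, j)` and `(j, i)` cancel and the diagonal terms vanish, so no division by two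
is needed. -/
theorem IsAlternating.dotProduct_mulVec_self {ι : Type*} [Fintype ι] {m : Matrix ι ι K}
    (hm : IsAlternating m) (u : ι → K) : u ⬝ᵥ (m *ᵥ u) = 0 := by
  classical
  have h : u ⬝ᵥ (m *ᵥ u) = ∑ p : ι × ι, u p.1 * (m p.1 p.2 * u p.2) := by
    rw [Fintype.sum_prod_type]
    simp [dotProduct, Matrix.mulVec, Finset.mul_sum]
  rw [h]
  refine Finset.sum_involution (fun p _ => (p.2, p.1)) ?_ ?_ ?_ ?_
  · rintro ⟨i, j⟩ -
    simp only
    rw [hm.skew i j]; ring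
  · rintro ⟨i, j⟩ - hne heq
    simp only [Prod.mk.injEq] at heq
    obtain ⟨rfl, -⟩ := heq
    simp [hm.diag] at hne
  · simp
  · simp

/-- A vector orthogonal to the kernel of an alternating matrix is in its image. -/
theorem IsAlternating.exists_mulVec_eq {ι : Type*} [Fintype ι] {m : Matrix ι ι K}
    (hm : IsAlternating m) {v : ι → K} (hv : ∀ w, m *ᵥ w = 0 → w ⬝ᵥ v = 0) :
    ∃ u, m *ᵥ u = v := by
  classical
  let φ : Module.Dual K (ι → K) := dotProductBilin K K v
  have hφ : φ ∈ (LinearMap.ker m.mulVecLin).dualAnnihilator := by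
    rw [Submodule.mem_dualAnnihilator]
    intro w hw
    have := hv w (by simpa using hw)
    simpa [φ, dotProduct_comm] using this
  rw [← LinearMap.range_dualMap_eq_dualAnnihilator_ker] at hφ
  obtain ⟨g, hg⟩ := hφ
  have hgd : ∀ x, g x = (fun i => g (Pi.single i 1)) ⬝ᵥ x := by
    intro x
    conv_lhs => rw [← Finset.univ_sum_single x]
    rw [map_sum]
    refine Finset.sum_congr rfl fun i _ => ?_
    have : (Pi.single i (x i) : ι → K) = x i • Pi.single i 1 := by
      rw [← Pi.single_smul]; simp
    rw [this, map_smul, smul_eq_mul, mul_comm]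
  -- The functional given by `v` kills the kernel, so it factors through `m` as `g`. Moving `m` to
  -- the other side of the dot product costs the sign.
  refine ⟨-(fun i => g (Pi.single i 1)), ?_⟩
  refine dotProduct_eq _ _ fun w => ?_
  have h1 : φ w = g (m *ᵥ w) := by rw [← hg]; rfl
  rw [hgd] at h1
  have h2 : φ w = v ⬝ᵥ w := rfl
  rw [← h2, h1, dotProduct_comm, hm.dotProduct_mulVec, neg_dotProduct, neg_neg]

/-- The alternating matrix obtained from `m` by adding `v` as last column and `-v` as last row. -/
def border {k : ℕ} (m : Matrix (Fin k) (Fin k) K) (v : Fin k → K) :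
    Matrix (Fin (k + 1)) (Fin (k + 1)) K :=
  Fin.snoc (α := fun _ => Fin (k + 1) → K) (fun i => Fin.snoc (α := fun _ => K) (m i) (v i))
    (Fin.snoc (α := fun _ => K) (-v) 0)

@[simp] theorem border_castSucc_castSucc {k : ℕ} (m : Matrix (Fin k) (Fin k) K) (v : Fin k → K)
    (i j : Fin k) : border m v i.castSucc j.castSucc = m i j := by simp [border]

@[simp] theorem border_castSucc_last {k : ℕ} (m : Matrix (Fin k) (Fin k) K) (v : Fin k → K)
    (i : Fin k) : border m v i.castSucc (Fin.last k) = v i := by simp [border]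

@[simp] theorem border_last_castSucc {k : ℕ} (m : Matrix (Fin k) (Fin k) K) (v : Fin k → K)
    (j : Fin k) : border m v (Fin.last k) j.castSucc = -v j := by simp [border]

@[simp] theorem border_last_last {k : ℕ} (m : Matrix (Fin k) (Fin k) K) (v : Fin k → K) :
    border m v (Fin.last k) (Fin.last k) = 0 := by simp [border]

theorem IsAlternating.border {k : ℕ} {m : Matrix (Fin k) (Fin k) K} (hm : IsAlternating m)
    (v : Fin k → K) : IsAlternating (border m v) := by
  constructor
  · intro i
    induction i using Fin.lastCases <;> simp [hm.diag]
  · intro i j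
    induction i using Fin.lastCases <;> induction j using Fin.lastCases <;> simp
    exact hm.skew _ _

theorem border_mulVec_snoc_eq_zero_iff {k : ℕ} {m : Matrix (Fin k) (Fin k) K} {v w : Fin k → K}
    {t : K} : border m v *ᵥ (Fin.snoc (α := fun _ => K) w t : Fin (k + 1) → K) = 0 ↔
      m *ᵥ w + t • v = 0 ∧ w ⬝ᵥ v = 0 := by
  constructor
  · intro h
    constructor
    · ext i
      have := congrFun h i.castSucc
      simpa [Matrix.mulVec, dotProduct, Fin.sum_univ_castSucc, mul_comm] using this
    · have := congrFun h (Fin.last k)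
      simpa [Matrix.mulVec, dotProduct, Fin.sum_univ_castSucc, mul_comm] using this
  · rintro ⟨h1, h2⟩
    ext i
    induction i using Fin.lastCases with
    | last => simpa [Matrix.mulVec, dotProduct, Fin.sum_univ_castSucc, mul_comm] using h2
    | cast i =>
      have := congrFun h1 i
      simpa [Matrix.mulVec, dotProduct, Fin.sum_univ_castSucc, mul_comm] using this

/-- Coranks are compared below by counting kernels, so that a bijection replaces a rank computation.
-/
theorem card_ker_eq_pow_corank [Fintype K] {k : ℕ} (m : Matrix (Fin k) (Fin k) K) :
    Nat.card {w : Fin k → K // m *ᵥ w = 0} = Fintype.card K ^ corank m := by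
  classical
  have h1 : Nat.card {w : Fin k → K // m *ᵥ w = 0} = Nat.card (LinearMap.ker m.mulVecLin) :=
    Nat.card_congr (Equiv.subtypeEquivRight fun w => by simp)
  have h2 := LinearMap.finrank_range_add_finrank_ker m.mulVecLin
  rw [h1, Nat.card_eq_fintype_card, Module.card_eq_pow_finrank (K := K)]
  congr 1
  rw [corank, Matrix.rank]
  simp only [Module.finrank_fintype_fun_eq_card, Fintype.card_fin] at h2
  omega

/-- Write `v = m *ᵥ u`. The kernel equation for `(w, t)` becomes that `w + t • u` is in the kernel
of `m`; the second equation, `w ⬝ᵥ v = 0`, then follows from skew-symmetry and `u ⬝ᵥ (m *ᵥ u) = 0`.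
So `t` is a free extra coordinate. -/
theorem corank_border_of_orthogonal [Fintype K] {k : ℕ} {m : Matrix (Fin k) (Fin k) K}
    (hm : IsAlternating m) {v : Fin k → K} (hv : ∀ w, m *ᵥ w = 0 → w ⬝ᵥ v = 0) :
    corank (border m v) = corank m + 1 := by
  obtain ⟨u, rfl⟩ := hm.exists_mulVec_eq hv
  refine Nat.pow_right_injective (Fintype.one_lt_card (α := K)) ?_
  simp only
  rw [← card_ker_eq_pow_corank, pow_succ, ← card_ker_eq_pow_corank, ← Nat.card_eq_fintype_card,
    ← Nat.card_prod]
  refine Nat.card_congr ⟨fun x => (⟨Fin.init x.1 + x.1 (Fin.last k) • u, ?_⟩, x.1 (Fin.last k)),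
    fun y => ⟨Fin.snoc (α := fun _ => K) (y.1.1 - y.2 • u) y.2, ?_⟩, ?_, ?_⟩
  · have h := x.2
    rw [← Fin.snoc_init_self x.1, border_mulVec_snoc_eq_zero_iff] at h
    rw [Matrix.mulVec_add, Matrix.mulVec_smul]
    exact h.1
  · rw [border_mulVec_snoc_eq_zero_iff]
    have h := y.1.2
    constructor
    · rw [Matrix.mulVec_sub, Matrix.mulVec_smul, h]; simp
    · rw [hm.dotProduct_mulVec, Matrix.mulVec_sub, Matrix.mulVec_smul, h]
      simp [hm.dotProduct_mulVec_self]
  · rintro ⟨x, hx⟩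
    simp
  · rintro ⟨⟨y, hy⟩, t⟩
    simp

/-- Pairing `m *ᵥ w + t • v = 0` with a kernel vector `w₀` not orthogonal to `v` forces `t = 0`. The
new kernel is thus the hyperplane of the old one orthogonal to `v`, and `w₀` spans a complement. -/
theorem corank_border_of_not_orthogonal [Fintype K] {k : ℕ} {m : Matrix (Fin k) (Fin k) K}
    (hm : IsAlternating m) {v : Fin k → K} (hv : ¬∀ w, m *ᵥ w = 0 → w ⬝ᵥ v = 0) :
    corank m = corank (border m v) + 1 := by
  push Not at hv
  obtain ⟨w₀, hw₀, hne⟩ := hv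
  refine Nat.pow_right_injective (Fintype.one_lt_card (α := K)) ?_
  simp only
  rw [← card_ker_eq_pow_corank, pow_succ, ← card_ker_eq_pow_corank, ← Nat.card_eq_fintype_card,
    ← Nat.card_prod]
  refine Nat.card_congr ⟨fun y => (⟨Fin.snoc (α := fun _ => K)
      (y.1 - ((y.1 ⬝ᵥ v) / (w₀ ⬝ᵥ v)) • w₀) 0, ?_⟩, (y.1 ⬝ᵥ v) / (w₀ ⬝ᵥ v)),
    fun x => ⟨Fin.init x.1.1 + x.2 • w₀, ?_⟩, ?_, ?_⟩
  · rw [border_mulVec_snoc_eq_zero_iff]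
    constructor
    · rw [Matrix.mulVec_sub, Matrix.mulVec_smul, hw₀, y.2]; simp
    · rw [sub_dotProduct, smul_dotProduct, smul_eq_mul, div_mul_cancel₀ _ hne, sub_self]
  all_goals
    have key : ∀ x : Fin (k + 1) → K, border m v *ᵥ x = 0 → x (Fin.last k) = 0 ∧
        m *ᵥ (Fin.init x) = 0 ∧ Fin.init x ⬝ᵥ v = 0 := by
      intro x h
      rw [← Fin.snoc_init_self x, border_mulVec_snoc_eq_zero_iff] at h
      have h0 := congrArg (fun z => w₀ ⬝ᵥ z) h.1
      simp only [dotProduct_add, hm.dotProduct_mulVec w₀, hw₀, dotProduct_smul, dotProduct_zero,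
        neg_zero, zero_add, smul_eq_mul, mul_eq_zero, hne, or_false] at h0
      have h1 := h.1
      rw [h0, zero_smul, add_zero] at h1
      exact ⟨h0, h1, h.2⟩
  · rw [Matrix.mulVec_add, Matrix.mulVec_smul, hw₀, (key _ x.1.2).2.1]; simp
  · rintro ⟨y, hy⟩
    simp
  · rintro ⟨⟨x, hx⟩, t⟩
    obtain ⟨h0, h1, h2⟩ := key x hx
    have : (Fin.init x + t • w₀) ⬝ᵥ v / w₀ ⬝ᵥ v = t := by
      rw [add_dotProduct, h2, smul_dotProduct, zero_add, smul_eq_mul, mul_div_cancel_right₀ _ hne]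
    simp only [this, add_sub_cancel_right, Prod.mk.injEq, and_true, Subtype.mk.injEq]
    rw [← h0, Fin.snoc_init_self]

end LinearAlgebra

/-! ### Characteristic functions and the probability of being orthogonal to a kernel. -/

section Fourier

variable {K : Type*} [Field K] [Fintype K]

/-- A mass function on a finite type. -/
structure IsLaw {S : Type*} [Fintype S] (p : S → ℝ) : Prop where
  nonneg : ∀ a, 0 ≤ p a
  sum_eq_one : ∑ a, p a = 1

theorem IsLaw.le_one {S : Type*} [Fintype S] {p : S → ℝ} (hp : IsLaw p) (a : S) : p a ≤ 1 := by
  rw [← hp.sum_eq_one]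
  exact Finset.single_le_sum (fun b _ => hp.nonneg b) (Finset.mem_univ a)

theorem IsLaw.prod {S ι : Type*} [Fintype S] [Fintype ι] [DecidableEq ι] {p : ι → S → ℝ}
    (hp : ∀ i, IsLaw (p i)) : IsLaw fun v : ι → S => ∏ i, p i (v i) := by
  constructor
  · exact fun v => Finset.prod_nonneg fun i _ => (hp i).nonneg _
  · rw [← Fintype.piFinset_univ, ← Finset.prod_univ_sum]
    simp [(hp _).sum_eq_one]

/-- The characteristic function of a mass function on `K` with respect to a character `ψ`. -/
noncomputable def charFn (ψ : AddChar K ℂ) (p : K → ℝ) (t : K) : ℂ := ∑ a, (p a : ℂ) * ψ (t * a)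

theorem charFn_zero (ψ : AddChar K ℂ) {p : K → ℝ} (hp : IsLaw p) : charFn ψ p 0 = 1 := by
  simp only [charFn, zero_mul, AddChar.map_zero_eq_one, mul_one]
  exact_mod_cast hp.sum_eq_one

/-- Parseval's identity: expand the square and use orthogonality of characters. -/
theorem sum_norm_charFn_sq {ψ : AddChar K ℂ} (hψ : ψ.IsPrimitive) (p : K → ℝ) :
    ∑ t, ‖charFn ψ p t‖ ^ 2 = Fintype.card K * ∑ a, p a ^ 2 := by
  classical
  have h : ∀ t, ((‖charFn ψ p t‖ ^ 2 : ℝ) : ℂ) =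
      ∑ a, ∑ b, (p a : ℂ) * p b * ψ (t * (a - b)) := by
    intro t
    rw [Complex.ofReal_pow, ← Complex.mul_conj', charFn, map_sum, Finset.sum_mul_sum]
    refine Finset.sum_congr rfl fun a _ => Finset.sum_congr rfl fun b _ => ?_
    rw [map_mul (starRingEnd ℂ), Complex.conj_ofReal, ← AddChar.map_neg_eq_conj, mul_sub, sub_eq_add_neg,
      AddChar.map_add_eq_mul]
    ring
  have h2 : ((∑ t, ‖charFn ψ p t‖ ^ 2 : ℝ) : ℂ) = ((Fintype.card K * ∑ a, p a ^ 2 : ℝ) : ℂ) := by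
    rw [Complex.ofReal_sum]
    simp_rw [h]
    rw [Finset.sum_comm]
    push_cast
    rw [Finset.mul_sum]
    refine Finset.sum_congr rfl fun a _ => ?_
    rw [Finset.sum_comm]
    simp_rw [← Finset.mul_sum, AddChar.sum_mulShift _ hψ, sub_eq_zero]
    simp
    ring
  exact_mod_cast h2

theorem sum_norm_charFn_sq_le {ψ : AddChar K ℂ} (hψ : ψ.IsPrimitive) {p : K → ℝ} (hp : IsLaw p)
    {τ : ℝ} (hτ : ∀ a, p a ≤ τ) : ∑ t, ‖charFn ψ p t‖ ^ 2 ≤ Fintype.card K * τ := by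
  rw [sum_norm_charFn_sq hψ]
  gcongr
  calc ∑ a, p a ^ 2 ≤ ∑ a, p a * τ := Finset.sum_le_sum fun a _ => by
        rw [sq]; exact mul_le_mul_of_nonneg_left (hτ a) (hp.nonneg a)
    _ = τ := by rw [← Finset.sum_mul, hp.sum_eq_one, one_mul]

theorem map_sum_addChar {ι A R : Type*} [AddCommMonoid A] [CommMonoid R] (ψ : AddChar A R)
    (s : Finset ι) (f : ι → A) : ψ (∑ i ∈ s, f i) = ∏ i ∈ s, ψ (f i) := by
  classical
  induction s using Finset.induction_on with
  | empty => simp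
  | insert a s ha ih => rw [Finset.sum_insert ha, Finset.prod_insert ha, ψ.map_add_eq_mul, ih]

theorem sum_prod_mul_addChar {ι : Type*} [Fintype ι] [DecidableEq ι] (ψ : AddChar K ℂ) (p : ι → K → ℝ)
    (w : ι → K) :
    ∑ v : ι → K, ((∏ i, p i (v i) : ℝ) : ℂ) * ψ (w ⬝ᵥ v) = ∏ i, charFn ψ (p i) (w i) := by
  simp only [charFn]
  rw [Finset.prod_univ_sum, Fintype.piFinset_univ]
  refine Finset.sum_congr rfl fun v _ => ?_
  rw [Finset.prod_mul_distrib, dotProduct, map_sum_addChar, Complex.ofReal_prod]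

/-- The number of frequencies where the characteristic function of a product law is large. -/
theorem card_large_charFn_le {ι : Type*} [Fintype ι] [DecidableEq ι] {ψ : AddChar K ℂ} (hψ : ψ.IsPrimitive)
    {p : ι → K → ℝ} (hp : ∀ i, IsLaw (p i)) {C : ℝ} (hC : 1 ≤ C) (S : Finset ι)
    (hS : ∀ i ∉ S, ∀ a, p i a ≤ C / Fintype.card K) {δ : ℝ} (hδ : 0 < δ)
    (B : Finset (ι → K)) (hB : ∀ w ∈ B, δ < ‖∏ i, charFn ψ (p i) (w i)‖) :
    (B.card : ℝ) * δ ^ 2 ≤ C ^ Fintype.card ι * (Fintype.card K : ℝ) ^ S.card := by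
  have hq : (0 : ℝ) < Fintype.card K := by exact_mod_cast Fintype.card_pos
  calc (B.card : ℝ) * δ ^ 2 = ∑ w ∈ B, δ ^ 2 := by rw [Finset.sum_const, nsmul_eq_mul]
    _ ≤ ∑ w ∈ B, ‖∏ i, charFn ψ (p i) (w i)‖ ^ 2 := by
        refine Finset.sum_le_sum fun w hw => ?_
        have := (hB w hw).le
        gcongr
    _ ≤ ∑ w : ι → K, ‖∏ i, charFn ψ (p i) (w i)‖ ^ 2 :=
        Finset.sum_le_univ_sum_of_nonneg fun w => sq_nonneg ‖∏ i, charFn ψ (p i) (w i)‖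
    _ = ∏ i, ∑ t, ‖charFn ψ (p i) t‖ ^ 2 := by
        rw [Finset.prod_univ_sum, Fintype.piFinset_univ]
        refine Finset.sum_congr rfl fun w _ => ?_
        rw [norm_prod, Finset.prod_pow]
    -- Parseval gives at most `C` for a near-uniform coordinate. A coordinate in `S` has only the
    -- trivial bound `q`, which is at most `C * q`.
    _ ≤ ∏ i, (C * if i ∈ S then (Fintype.card K : ℝ) else 1) := by
        refine Finset.prod_le_prod (fun i _ => Finset.sum_nonneg fun t _ => sq_nonneg _)
          fun i _ => ?_
        split_ifs with h
        · refine (sum_norm_charFn_sq_le hψ (hp i) (hp i).le_one).trans ?_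
          nlinarith
        · refine (sum_norm_charFn_sq_le hψ (hp i) (hS i h)).trans_eq ?_
          rw [mul_div_cancel₀ _ hq.ne', mul_one]
    _ = C ^ Fintype.card ι * (Fintype.card K : ℝ) ^ S.card := by
        rw [Finset.prod_mul_distrib, Finset.prod_const, Finset.card_univ, Finset.prod_ite_mem,
          Finset.univ_inter, Finset.prod_const]

open Classical in
/-- The probability, under the product of the laws `p i`, that a vector is orthogonal to the
kernel of `m`. -/
noncomputable def orthMass {k : ℕ} (p : Fin k → K → ℝ) (m : Matrix (Fin k) (Fin k) K) : ℝ :=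
  ∑ v : Fin k → K, if ∀ w, m *ᵥ w = 0 → w ⬝ᵥ v = 0 then ∏ i, p i (v i) else 0

theorem orthMass_nonneg {k : ℕ} {p : Fin k → K → ℝ} (hp : ∀ i, IsLaw (p i))
    (m : Matrix (Fin k) (Fin k) K) : 0 ≤ orthMass p m :=
  Finset.sum_nonneg fun v _ => by
    split_ifs
    exacts [(IsLaw.prod hp).nonneg v, le_rfl]

theorem orthMass_le_one {k : ℕ} {p : Fin k → K → ℝ} (hp : ∀ i, IsLaw (p i))
    (m : Matrix (Fin k) (Fin k) K) : orthMass p m ≤ 1 := by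
  rw [← (IsLaw.prod hp).sum_eq_one]
  refine Finset.sum_le_sum fun v _ => ?_
  split_ifs
  exacts [le_rfl, (IsLaw.prod hp).nonneg v]

-- Orthogonality for the character `w ↦ ψ (w ⬝ᵥ v)` of the kernel. It is trivial only if `v` is
-- orthogonal to the kernel: the kernel is closed under scaling and `ψ` is primitive.
open Classical in
theorem sum_ker_addChar {k : ℕ} {ψ : AddChar K ℂ} (hψ : ψ.IsPrimitive)
    (m : Matrix (Fin k) (Fin k) K) (v : Fin k → K) :
    ∑ w : Fin k → K, (if m *ᵥ w = 0 then ψ (w ⬝ᵥ v) else 0) =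
      if ∀ w, m *ᵥ w = 0 → w ⬝ᵥ v = 0 then ((Fintype.card K : ℂ) ^ corank m) else 0 := by
  let V := LinearMap.ker m.mulVecLin
  let χ : AddChar V ℂ :=
    { toFun := fun w => ψ ((w : Fin k → K) ⬝ᵥ v)
      map_zero_eq_one' := by simp
      map_add_eq_mul' := fun a b => by simp [add_dotProduct, AddChar.map_add_eq_mul] }
  have hχ : χ = 0 ↔ ∀ w, m *ᵥ w = 0 → w ⬝ᵥ v = 0 := by
    constructor
    · intro h w hw
      by_contra hne
      refine hψ hne ?_
      ext c
      have hmem : c • w ∈ V := by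
        simp only [V, LinearMap.mem_ker, Matrix.mulVecLin_apply, Matrix.mulVec_smul, hw, smul_zero]
      have h1 : χ ⟨c • w, hmem⟩ = 1 := by rw [h]; rfl
      have h2 : χ ⟨c • w, hmem⟩ = ψ ((c • w) ⬝ᵥ v) := rfl
      rw [AddChar.mulShift_apply, AddChar.one_apply, ← h1, h2, smul_dotProduct, smul_eq_mul,
        mul_comm]
    · intro h
      ext w
      have h2 : χ w = ψ ((w : Fin k → K) ⬝ᵥ v) := rfl
      rw [h2, h _ (LinearMap.mem_ker.1 w.2), AddChar.map_zero_eq_one]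
      rfl
  have hcard : (Fintype.card V : ℂ) = (Fintype.card K : ℂ) ^ corank m := by
    have := card_ker_eq_pow_corank m
    rw [← Nat.cast_pow, ← this, ← Nat.card_eq_fintype_card]
    refine congrArg _ ?_
    exact Nat.card_congr (Equiv.subtypeEquivRight fun w => by simp [V])
  have hsum : ∑ w : Fin k → K, (if m *ᵥ w = 0 then ψ (w ⬝ᵥ v) else 0) = ∑ w : V, χ w := by
    rw [← Finset.sum_filter]
    exact Finset.sum_subtype _ (p := fun w => w ∈ V) (by simp [V]) fun w => ψ (w ⬝ᵥ v)
  rw [hsum, AddChar.sum_eq_ite]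
  simp only [hχ, hcard]

-- Poisson summation over the kernel: average the preceding identity over `v`.
open Classical in
theorem card_ker_mul_orthMass {k : ℕ} {ψ : AddChar K ℂ} (hψ : ψ.IsPrimitive)
    (p : Fin k → K → ℝ) (m : Matrix (Fin k) (Fin k) K) :
    (Fintype.card K : ℂ) ^ corank m * (orthMass p m : ℂ) =
      ∑ w : Fin k → K, if m *ᵥ w = 0 then ∏ i, charFn ψ (p i) (w i) else 0 := by
  simp_rw [← sum_prod_mul_addChar]
  have : ∀ w : Fin k → K, (if m *ᵥ w = 0 then
      ∑ v : Fin k → K, ((∏ i, p i (v i) : ℝ) : ℂ) * ψ (w ⬝ᵥ v) else 0) =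
      ∑ v : Fin k → K, ((∏ i, p i (v i) : ℝ) : ℂ) * (if m *ᵥ w = 0 then ψ (w ⬝ᵥ v) else 0) := by
    intro w
    split_ifs <;> simp
  simp_rw [this]
  rw [Finset.sum_comm]
  simp_rw [← Finset.mul_sum, sum_ker_addChar hψ]
  rw [orthMass, Complex.ofReal_sum, Finset.mul_sum]
  refine Finset.sum_congr rfl fun v _ => ?_
  split_ifs
  · ring
  · simp

/-- If the characteristic function is small on the nonzero kernel vectors of `m`, then a random
vector is orthogonal to the kernel with nearly the uniform probability. -/
theorem abs_orthMass_sub_le {k : ℕ} {ψ : AddChar K ℂ} (hψ : ψ.IsPrimitive)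
    {p : Fin k → K → ℝ} (hp : ∀ i, IsLaw (p i)) (m : Matrix (Fin k) (Fin k) K) {δ : ℝ}
    (hm : ∀ w, w ≠ 0 → m *ᵥ w = 0 → ‖∏ i, charFn ψ (p i) (w i)‖ ≤ δ) (hδ : 0 ≤ δ) :
    |orthMass p m - ((Fintype.card K : ℝ) ^ corank m)⁻¹| ≤ δ := by
  classical
  have hq : (0 : ℝ) < (Fintype.card K : ℝ) ^ corank m := by
    have : (0 : ℝ) < Fintype.card K := by exact_mod_cast Fintype.card_pos
    positivity
  have h1 := card_ker_mul_orthMass hψ p m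
  -- The zero frequency contributes the main term 1; the other kernel vectors contribute at most `δ`
  -- each, and there are fewer than `q ^ corank m` of them.
  rw [Fintype.sum_eq_add_sum_compl 0] at h1
  simp only [Matrix.mulVec_zero, if_true, Pi.zero_apply, charFn_zero ψ (hp _),
    Finset.prod_const_one] at h1
  have h2 : ‖∑ w ∈ ({0}ᶜ : Finset (Fin k → K)),
      if m *ᵥ w = 0 then ∏ i, charFn ψ (p i) (w i) else 0‖ ≤ (Fintype.card K : ℝ) ^ corank m * δ := by
    calc _ ≤ ∑ w ∈ ({0}ᶜ : Finset (Fin k → K)), (if m *ᵥ w = 0 then δ else 0) := by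
          refine (norm_sum_le _ _).trans (Finset.sum_le_sum fun w hw => ?_)
          split_ifs with h
          · exact hm w (by simpa using hw) h
          · simp
      _ ≤ ∑ w : Fin k → K, (if m *ᵥ w = 0 then δ else 0) :=
          Finset.sum_le_sum_of_subset_of_nonneg (Finset.subset_univ _) fun _ _ _ => by
            split_ifs <;> simp [hδ]
      _ = (Fintype.card K : ℝ) ^ corank m * δ := by
          rw [← Finset.sum_filter, Finset.sum_const, nsmul_eq_mul]
          congr 1
          rw [← Nat.cast_pow, ← card_ker_eq_pow_corank, Nat.card_eq_fintype_card,
            Fintype.card_subtype]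
  have h3 : (((Fintype.card K : ℝ) ^ corank m * orthMass p m - 1 : ℝ) : ℂ) =
      ∑ w ∈ ({0}ᶜ : Finset (Fin k → K)),
        if m *ᵥ w = 0 then ∏ i, charFn ψ (p i) (w i) else 0 := by
    push_cast
    rw [h1]; ring
  rw [← h3, Complex.norm_real, Real.norm_eq_abs] at h2
  have h4 : orthMass p m - ((Fintype.card K : ℝ) ^ corank m)⁻¹ =
      ((Fintype.card K : ℝ) ^ corank m)⁻¹ * ((Fintype.card K : ℝ) ^ corank m * orthMass p m - 1) := by
    field_simp
  rw [h4, abs_mul, abs_of_pos (inv_pos.2 hq), inv_mul_le_iff₀ hq]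
  exact h2

end Fourier

/-! ### Random matrices with independent entries, and comparison of the corank with a Markov chain.
-/

section RandomAlternating

variable {K : Type*} [Field K] [Fintype K]

/-- The expectation of `f` at the random alternating `k × k` matrix whose entries `(i, j)`, `i < j`,
are independent with laws `p i j`. -/
noncomputable def expect (p : ℕ → ℕ → K → ℝ) :
    (k : ℕ) → (Matrix (Fin k) (Fin k) K → ℝ) → ℝ
  | 0, f => f 0
  | k + 1, f => expect p k fun m =>
      ∑ v : Fin k → K, (∏ i : Fin k, p i k (v i)) * f (border m v)

variable {p : ℕ → ℕ → K → ℝ}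

/-- Each bordering moves the corank by exactly one, so the parity relation holds at every matrix
reached and the pointwise comparison is needed only there. -/
theorem expect_mono (hp : ∀ i j, IsLaw (p i j)) {k : ℕ} {f g : Matrix (Fin k) (Fin k) K → ℝ}
    (h : ∀ m, IsAlternating m → Even (corank m + k) → f m ≤ g m) :
    expect p k f ≤ expect p k g := by
  induction k with
  | zero =>
    refine h 0 ⟨fun i => rfl, fun i j => by simp⟩ ?_
    simp [corank]
  | succ k ih =>
    refine ih fun m hm he => Finset.sum_le_sum fun v _ => ?_
    refine mul_le_mul_of_nonneg_left (h _ (hm.border v) ?_)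
      (Finset.prod_nonneg fun i _ => (hp _ _).nonneg _)
    by_cases hv : ∀ w, m *ᵥ w = 0 → w ⬝ᵥ v = 0
    · rw [corank_border_of_orthogonal hm hv]
      rw [show corank m + 1 + (k + 1) = corank m + k + 2 by omega]
      exact he.add even_two
    · have := corank_border_of_not_orthogonal hm hv
      convert he using 1
      omega

theorem expect_congr (hp : ∀ i j, IsLaw (p i j)) {k : ℕ} {f g : Matrix (Fin k) (Fin k) K → ℝ}
    (h : ∀ m, IsAlternating m → Even (corank m + k) → f m = g m) :
    expect p k f = expect p k g :=
  (expect_mono hp fun m hm he => (h m hm he).le).antisymm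
    (expect_mono hp fun m hm he => (h m hm he).ge)

theorem expect_add {k : ℕ} (f g : Matrix (Fin k) (Fin k) K → ℝ) :
    expect p k (fun m => f m + g m) = expect p k f + expect p k g := by
  induction k with
  | zero => rfl
  | succ k ih => simp only [expect, mul_add, Finset.sum_add_distrib, ih]

theorem expect_const_mul {k : ℕ} (c : ℝ) (f : Matrix (Fin k) (Fin k) K → ℝ) :
    expect p k (fun m => c * f m) = c * expect p k f := by
  induction k with
  | zero => rfl
  | succ k ih =>
    simp only [expect, ← ih, Finset.mul_sum, mul_left_comm c]

theorem expect_sub {k : ℕ} (f g : Matrix (Fin k) (Fin k) K → ℝ) :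
    expect p k (fun m => f m - g m) = expect p k f - expect p k g := by
  have h := expect_add (p := p) f (fun m => -1 * g m)
  rw [expect_const_mul] at h
  simpa [sub_eq_add_neg] using h

theorem expect_const (hp : ∀ i j, IsLaw (p i j)) (k : ℕ) (c : ℝ) :
    expect p k (fun _ => c) = c := by
  induction k with
  | zero => rfl
  | succ k ih =>
    simp only [expect, ← Finset.sum_mul]
    rw [(IsLaw.prod fun i : Fin k => hp i k).sum_eq_one, one_mul, ih]

theorem expect_sum {α : Type*} (s : Finset α) {k : ℕ} (f : α → Matrix (Fin k) (Fin k) K → ℝ) :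
    expect p k (fun m => ∑ a ∈ s, f a m) = ∑ a ∈ s, expect p k (f a) := by
  classical
  induction s using Finset.induction_on with
  | empty => simpa using expect_const_mul (p := p) 0 (fun _ : Matrix (Fin k) (Fin k) K => 0)
  | insert a s ha ih => simp only [Finset.sum_insert ha, expect_add, ih]

theorem abs_expect_le (hp : ∀ i j, IsLaw (p i j)) {k : ℕ} (f : Matrix (Fin k) (Fin k) K → ℝ) :
    |expect p k f| ≤ expect p k (fun m => |f m|) := by
  rw [abs_le]
  constructor
  · have := expect_mono hp (k := k) (f := fun m => -1 * |f m|) (g := f)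
      fun m _ _ => by linarith [neg_abs_le (f m)]
    rw [expect_const_mul] at this
    linarith
  · exact expect_mono hp fun m _ _ => le_abs_self _

-- Freeze all coordinates except `j`: since `w j ≠ 0`, the equation leaves one value for coordinate
-- `j`.
open Classical in
theorem sum_prod_dotProduct_eq_zero_le {ι : Type*} [Fintype ι] [DecidableEq ι] {r : ι → K → ℝ}
    (hr : ∀ i, IsLaw (r i)) {w : ι → K} {j : ι} (hj : w j ≠ 0) {τ : ℝ} (hτ : ∀ a, r j a ≤ τ) :
    ∑ v : ι → K, (if w ⬝ᵥ v = 0 then ∏ i, r i (v i) else 0) ≤ τ := by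
  have hstep : ∀ (a : K) (y : {i // i ≠ j} → K),
      (if w ⬝ᵥ ((Equiv.funSplitAt j K).symm (a, y)) = 0 then
        ∏ i, r i ((Equiv.funSplitAt j K).symm (a, y) i) else 0) =
      (∏ i : {i // i ≠ j}, r i (y i)) *
        (if a = -(∑ i : {i // i ≠ j}, w i * y i) / w j then r j a else 0) := by
    intro a y
    have h1 : ∏ i, r i ((Equiv.funSplitAt j K).symm (a, y) i) =
        r j a * ∏ i : {i // i ≠ j}, r i (y i) := by
      rw [Fintype.prod_eq_mul_prod_subtype_ne _ j]
      congr 1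
      · simp
      · refine Finset.prod_congr rfl fun i _ => ?_
        simp [i.2]
    have h2 : w ⬝ᵥ ((Equiv.funSplitAt j K).symm (a, y)) =
        w j * a + ∑ i : {i // i ≠ j}, w i * y i := by
      rw [dotProduct, Fintype.sum_eq_add_sum_subtype_ne _ j]
      congr 1
      · simp
      · refine Finset.sum_congr rfl fun i _ => ?_
        simp [i.2]
    have h3 : w j * a + ∑ i : {i // i ≠ j}, w i * y i = 0 ↔
        a = -(∑ i : {i // i ≠ j}, w i * y i) / w j := by
      rw [eq_div_iff hj, ← eq_neg_iff_add_eq_zero, mul_comm]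
    rw [h1, h2]
    simp only [h3, mul_ite, mul_zero]
    split_ifs <;> ring
  rw [← Equiv.sum_comp (Equiv.funSplitAt j K).symm, Fintype.sum_prod_type_right]
  simp_rw [hstep, ← Finset.mul_sum]
  calc _ ≤ ∑ y : {i // i ≠ j} → K, (∏ i : {i // i ≠ j}, r i (y i)) * τ := by
        refine Finset.sum_le_sum fun y _ => mul_le_mul_of_nonneg_left ?_
          (Finset.prod_nonneg fun i _ => (hr i).nonneg _)
        simp [hτ]
    _ = τ := by
        rw [← Finset.sum_mul, (IsLaw.prod fun i : {i // i ≠ j} => hr i).sum_eq_one, one_mul]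

open Classical in
/-- A fixed nonzero vector is in the kernel of the random matrix with small probability. -/
theorem exists_expect_mulVec_eq_zero_le (hp : ∀ i j, IsLaw (p i j)) {τ : ℝ} (hτ0 : 0 ≤ τ)
    {N : ℕ → Finset ℕ} (hN : ∀ i j, i ∈ N j ↔ j ∈ N i)
    (hτ : ∀ i j, i < j → i ∉ N j → ∀ a, p i j a ≤ τ) {k : ℕ} (w : Fin k → K) (hw : w ≠ 0) :
    ∃ j : Fin k, w j ≠ 0 ∧ expect p k (fun m => if m *ᵥ w = 0 then 1 else 0) ≤
      ∏ i : Fin k, if i = j ∨ (i : ℕ) ∈ N j then 1 else τ := by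
  induction k with
  | zero => exact (hw (Subsingleton.elim _ _)).elim
  | succ k ih =>
    obtain ⟨w, t, rfl⟩ : ∃ (w' : Fin k → K) (t : K), w = Fin.snoc (α := fun _ => K) w' t :=
      ⟨Fin.init w, w (Fin.last k), (Fin.snoc_init_self w).symm⟩
    simp only [expect, border_mulVec_snoc_eq_zero_iff]
    -- If `t = 0`, the index `j` comes from the induction, and the new column only has to be
    -- orthogonal to `w`; this costs a factor `τ` unless its entry at `j` is exceptional.
    by_cases ht : t = 0
    · subst ht
      have hw' : w ≠ 0 := by
        rintro rfl
        refine hw (funext fun i => ?_)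
        induction i using Fin.lastCases <;> simp
      obtain ⟨j, hj, hle⟩ := ih w hw'
      refine ⟨j.castSucc, by simpa using hj, ?_⟩
      set s : ℝ := if k ∈ N j then 1 else τ with hs
      have hle2 : expect p k (fun m => ∑ v : Fin k → K, (∏ i : Fin k, p i k (v i)) *
          if m *ᵥ w + (0 : K) • v = 0 ∧ w ⬝ᵥ v = 0 then 1 else 0) ≤
          expect p k (fun m => s * if m *ᵥ w = 0 then 1 else 0) := by
        refine expect_mono hp fun m _ _ => ?_
        by_cases hm : m *ᵥ w = 0
        · simp only [hm, zero_smul, add_zero, true_and, if_true, mul_ite, mul_one, mul_zero]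
          rw [hs]
          split_ifs with h
          · rw [← (IsLaw.prod fun i : Fin k => hp i k).sum_eq_one]
            refine Finset.sum_le_sum fun v _ => ?_
            split_ifs
            exacts [le_rfl, (IsLaw.prod fun i : Fin k => hp i k).nonneg v]
          · exact sum_prod_dotProduct_eq_zero_le (fun i : Fin k => hp i k) hj
              (hτ _ _ j.2 (by rwa [hN]))
        · simp [hm]
      refine hle2.trans ?_
      rw [expect_const_mul, Fin.prod_univ_castSucc, mul_comm]
      have : (if Fin.last k = j.castSucc ∨ ((Fin.last k : Fin (k + 1)) : ℕ) ∈ N (j.castSucc : ℕ)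
          then 1 else τ) = s := by
        simp [hs, (Fin.castSucc_lt_last j).ne']
      rw [this]
      refine mul_le_mul_of_nonneg_right (hle.trans_eq ?_) (by rw [hs]; split_ifs <;> simp [hτ0])
      simp
    -- If `t ≠ 0`, the equation `m *ᵥ w + t • v = 0` prescribes the whole column `v`, so the bound
    -- holds for every fixed `m` and the other equation can be dropped.
    · refine ⟨Fin.last k, by simpa using ht, ?_⟩
      have hle2 : expect p k (fun m => ∑ v : Fin k → K, (∏ i : Fin k, p i k (v i)) *
          if m *ᵥ w + t • v = 0 ∧ w ⬝ᵥ v = 0 then 1 else 0) ≤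
          expect p k (fun _ => ∏ i : Fin k, if (i : ℕ) ∈ N k then 1 else τ) := by
        refine expect_mono hp fun m _ _ => ?_
        have h1 : ∀ v : Fin k → K, (∏ i : Fin k, p i k (v i)) *
            (if m *ᵥ w + t • v = 0 ∧ w ⬝ᵥ v = 0 then 1 else 0) ≤
            if v = -t⁻¹ • (m *ᵥ w) then ∏ i : Fin k, p i k (v i) else 0 := by
          intro v
          have hnn := (IsLaw.prod fun i : Fin k => hp i k).nonneg v
          split_ifs with ha hb hb
          · simp
          · refine (hb ?_).elim
            have h2 : t • v = -(m *ᵥ w) := eq_neg_of_add_eq_zero_right ha.1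
            rw [neg_smul, ← smul_neg, ← h2, smul_smul, inv_mul_cancel₀ ht, one_smul]
          · simpa using hnn
          · simp
        refine (Finset.sum_le_sum fun v _ => h1 v).trans ?_
        rw [Finset.sum_ite_eq' Finset.univ, if_pos (Finset.mem_univ _)]
        refine Finset.prod_le_prod (fun i _ => (hp _ _).nonneg _) fun i _ => ?_
        split_ifs with h
        · exact (hp _ _).le_one _
        · exact hτ _ _ i.2 h _
      refine hle2.trans ?_
      rw [expect_const hp, Fin.prod_univ_castSucc]
      simp [(Fin.castSucc_lt_last _).ne]

-- The exponent discards the index `j` itself and at most `b` exceptional positions.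
open Classical in
theorem expect_mulVec_eq_zero_le (hp : ∀ i j, IsLaw (p i j)) {τ : ℝ} (hτ0 : 0 ≤ τ) (hτ1 : τ ≤ 1)
    {N : ℕ → Finset ℕ} (hN : ∀ i j, i ∈ N j ↔ j ∈ N i)
    (hτ : ∀ i j, i < j → i ∉ N j → ∀ a, p i j a ≤ τ) {b : ℕ} (hb : ∀ j, (N j).card ≤ b)
    {k : ℕ} (w : Fin k → K) (hw : w ≠ 0) :
    expect p k (fun m => if m *ᵥ w = 0 then 1 else 0) ≤ τ ^ (k - 1 - b) := by
  obtain ⟨j, -, hj⟩ := exists_expect_mulVec_eq_zero_le hp hτ0 hN hτ w hw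
  refine hj.trans ?_
  rw [Finset.prod_ite, Finset.prod_const_one, one_mul, Finset.prod_const]
  refine pow_le_pow_of_le_one hτ0 hτ1 ?_
  have h1 : (Finset.univ.filter fun i : Fin k => i = j ∨ (i : ℕ) ∈ N j).card ≤ 1 + b := by
    rw [Finset.filter_or]
    refine (Finset.card_union_le _ _).trans (add_le_add ?_ ((?_ : _ ≤ (N j).card).trans (hb j)))
    · simp [Finset.filter_eq']
    · refine Finset.card_le_card_of_injOn (fun i : Fin k => (i : ℕ)) ?_ Fin.val_injective.injOn
      intro i hi
      simpa using hi
  have h2 := Finset.card_filter_add_card_filter_not (s := Finset.univ)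
    (fun i : Fin k => i = j ∨ (i : ℕ) ∈ N j)
  simp only [Finset.card_univ, Fintype.card_fin] at h2
  omega

/-- The mean deviation of the probability that the corank increases from its uniform value. -/
noncomputable def stepError (p : ℕ → ℕ → K → ℝ) (k : ℕ) : ℝ :=
  expect p k fun m =>
    |orthMass (fun i : Fin k => p i k) m - ((Fintype.card K : ℝ) ^ corank m)⁻¹|

theorem inv_card_pow_mem (K : Type*) [Field K] [Fintype K] (d : ℕ) :
    0 ≤ ((Fintype.card K : ℝ) ^ d)⁻¹ ∧ ((Fintype.card K : ℝ) ^ d)⁻¹ ≤ 1 := by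
  refine ⟨by positivity, inv_le_one_of_one_le₀ (one_le_pow₀ ?_)⟩
  exact_mod_cast Fintype.card_pos (α := K)

/-- Call a nonzero vector bad if the characteristic function of the new column exceeds `δ` there.
With no bad vector in the kernel the deviation is at most `δ`, and in general it is at most 1. The
second term is the Parseval count of bad vectors times the probability that a given one is in the
kernel. -/
theorem stepError_le (hp : ∀ i j, IsLaw (p i j)) {C : ℝ} (hC : 1 ≤ C)
    (hCq : C ≤ Fintype.card K) {N : ℕ → Finset ℕ} (hN : ∀ i j, i ∈ N j ↔ j ∈ N i)
    (hτ : ∀ i j, i < j → i ∉ N j → ∀ a, p i j a ≤ C / Fintype.card K) {b : ℕ}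
    (hb : ∀ j, (N j).card ≤ b) (k : ℕ) {δ : ℝ} (hδ : 0 < δ) :
    stepError p k ≤ δ + C ^ k * (Fintype.card K : ℝ) ^ b / δ ^ 2 *
      (C / Fintype.card K) ^ (k - 1 - b) := by
  classical
  have hq1 : (1 : ℝ) ≤ Fintype.card K := hC.trans hCq
  obtain ⟨ψ, hψ⟩ : ∃ ψ : AddChar K ℂ, ψ.IsPrimitive := by
    refine ⟨AddChar.FiniteField.primitiveChar_to_Complex K, ?_⟩
    exact AddChar.FiniteField.primitiveChar_to_Complex_isPrimitive K
  let B : Finset (Fin k → K) := Finset.univ.filter fun w =>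
    w ≠ 0 ∧ δ < ‖∏ i : Fin k, charFn ψ (p i k) (w i)‖
  let S : Finset (Fin k) := Finset.univ.filter fun i => (i : ℕ) ∈ N k
  have hS : S.card ≤ b := by
    refine le_trans ?_ (hb k)
    refine Finset.card_le_card_of_injOn (fun i : Fin k => (i : ℕ)) ?_ Fin.val_injective.injOn
    intro i hi
    simpa [S] using hi
  have hcard : (B.card : ℝ) ≤ C ^ k * (Fintype.card K : ℝ) ^ b / δ ^ 2 := by
    rw [le_div_iff₀ (by positivity)]
    refine (card_large_charFn_le hψ (fun i : Fin k => hp i k) hC S (fun i hi a => ?_) hδ B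
      (fun w hw => ?_)).trans ?_
    · exact hτ i k i.2 (by simpa [S] using hi) a
    · simpa [B] using (Finset.mem_filter.1 hw).2.2
    · rw [Fintype.card_fin]
      gcongr
  have hτ0 : 0 ≤ C / (Fintype.card K : ℝ) := by positivity
  have hτ1 : C / (Fintype.card K : ℝ) ≤ 1 := (div_le_one (by linarith)).2 hCq
  calc stepError p k ≤ expect p k
        (fun m => δ + ∑ w ∈ B, if m *ᵥ w = 0 then 1 else 0) := by
        refine expect_mono hp fun m _ _ => ?_
        by_cases h : ∃ w ∈ B, m *ᵥ w = 0
        · obtain ⟨w, hw, hmw⟩ := h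
          have h1 : (1 : ℝ) ≤ ∑ w ∈ B, if m *ᵥ w = 0 then 1 else 0 := by
            refine le_trans ?_ (Finset.single_le_sum (fun u _ => ?_) hw)
            · simp [hmw]
            · split_ifs <;> simp
          have h2 := orthMass_nonneg (fun i : Fin k => hp i k) m
          have h3 := orthMass_le_one (fun i : Fin k => hp i k) m
          obtain ⟨h4, h5⟩ := inv_card_pow_mem K (corank m)
          have h6 : |orthMass (fun i : Fin k => p i k) m - ((Fintype.card K : ℝ) ^ corank m)⁻¹|
              ≤ 1 := by
            rw [abs_le]; constructor <;> linarith
          linarith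
        · push Not at h
          refine (abs_orthMass_sub_le hψ (fun i : Fin k => hp i k) m (fun w hw hmw => ?_)
            hδ.le).trans (le_add_of_nonneg_right (Finset.sum_nonneg fun u _ => ?_))
          · by_contra hlt
            exact h w (Finset.mem_filter.2 ⟨Finset.mem_univ _, hw, not_le.1 hlt⟩) hmw
          · split_ifs <;> simp
    _ = δ + ∑ w ∈ B, expect p k (fun m => if m *ᵥ w = 0 then 1 else 0) := by
        rw [expect_add, expect_const hp, expect_sum]
    _ ≤ δ + ∑ w ∈ B, (C / Fintype.card K) ^ (k - 1 - b) := by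
        gcongr with w hw
        exact expect_mulVec_eq_zero_le hp hτ0 hτ1 hN hτ hb w (Finset.mem_filter.1 hw).2.1
    _ ≤ _ := by
        rw [Finset.sum_const, nsmul_eq_mul]
        gcongr

/-- Needed for small sizes, where the union bound is too weak. If the kernel is nonzero, both
probabilities lie between 0 and `C / q`; if it is zero, both equal 1. -/
theorem stepError_le_of_free (hp : ∀ i j, IsLaw (p i j)) {C : ℝ} (hC : 1 ≤ C)
    (hτ : ∀ i j, i < j → ∀ a, p i j a ≤ C / Fintype.card K) (k : ℕ) :
    stepError p k ≤ C / Fintype.card K := by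
  classical
  have hq1 : (1 : ℝ) ≤ Fintype.card K := by exact_mod_cast Fintype.card_pos (α := K)
  have hτ0 : 0 ≤ C / (Fintype.card K : ℝ) := by positivity
  rw [← expect_const hp k (C / Fintype.card K)]
  refine expect_mono hp fun m _ _ => ?_
  have ho := orthMass_nonneg (fun i : Fin k => hp i k) m
  by_cases h : ∃ w, w ≠ 0 ∧ m *ᵥ w = 0
  · obtain ⟨w, hw, hmw⟩ := h
    obtain ⟨j, hj⟩ := Function.ne_iff.1 hw
    have h1 : orthMass (fun i : Fin k => p i k) m ≤ C / Fintype.card K := by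
      refine le_trans ?_ (sum_prod_dotProduct_eq_zero_le (fun i : Fin k => hp i k) (w := w) hj
        (hτ j k j.2))
      refine Finset.sum_le_sum fun v _ => ?_
      have hnn := (IsLaw.prod fun i : Fin k => hp i k).nonneg v
      split_ifs with ha hb hb
      · exact le_rfl
      · exact (hb (ha w hmw)).elim
      · exact hnn
      · exact le_rfl
    have hd : corank m ≠ 0 := by
      intro h0
      have := card_ker_eq_pow_corank m
      rw [h0, pow_zero, Nat.card_eq_one_iff_unique] at this
      have := @Subsingleton.elim _ this.1 ⟨w, hmw⟩ ⟨0, by simp⟩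
      exact hw (congrArg Subtype.val this)
    have h2 : ((Fintype.card K : ℝ) ^ corank m)⁻¹ ≤ C / Fintype.card K := by
      rw [← one_div]
      exact div_le_div₀ (by linarith) hC (by linarith) (le_self_pow₀ hq1 hd)
    have h3 := (inv_card_pow_mem K (corank m)).1
    rw [abs_le]; constructor <;> linarith
  · push Not at h
    have h1 : ∀ w, m *ᵥ w = 0 → w = 0 := fun w hmw => by
      by_contra hw
      exact h w hw hmw
    have hd : corank m = 0 := by
      have := card_ker_eq_pow_corank m
      have hcard : Nat.card {w : Fin k → K // m *ᵥ w = 0} = 1 := by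
        rw [Nat.card_eq_one_iff_unique]
        exact ⟨⟨fun a b => Subtype.ext ((h1 _ a.2).trans (h1 _ b.2).symm)⟩, ⟨⟨0, by simp⟩⟩⟩
      rw [hcard] at this
      by_contra hne
      exact (Nat.one_lt_pow hne Fintype.one_lt_card).ne this
    have h2 : orthMass (fun i : Fin k => p i k) m = 1 := by
      rw [← (IsLaw.prod fun i : Fin k => hp i k).sum_eq_one]
      refine Finset.sum_congr rfl fun v _ => if_pos fun w hmw => ?_
      rw [h1 w hmw, zero_dotProduct]
    simpa [hd, h2] using hτ0

/-- The transition operator of the corank of uniform alternating matrices of growing size. -/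
noncomputable def chainStep (q : ℝ) (f : ℕ → ℝ) (j : ℕ) : ℝ :=
  (if j = 0 then 0 else f (j - 1) * (q ^ (j - 1))⁻¹) + f (j + 1) * (1 - (q ^ (j + 1))⁻¹)

/-- The mass function of the corank of the random `k × k` matrix. -/
noncomputable def corankMass (p : ℕ → ℕ → K → ℝ) (k j : ℕ) : ℝ :=
  expect p k fun m => if corank m = j then 1 else 0

theorem corankMass_succ (hp : ∀ i j, IsLaw (p i j)) (k j : ℕ) :
    corankMass p (k + 1) j = expect p k fun m =>
      orthMass (fun i : Fin k => p i k) m * (if corank m + 1 = j then 1 else 0) +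
      (1 - orthMass (fun i : Fin k => p i k) m) * (if corank m = j + 1 then 1 else 0) := by
  classical
  change expect p k (fun m => ∑ v : Fin k → K, (∏ i : Fin k, p i k (v i)) *
    (if corank (border m v) = j then (1 : ℝ) else 0)) = _
  refine expect_congr hp fun m hm _ => ?_
  have h1 : ∀ v : Fin k → K, (∏ i : Fin k, p i k (v i)) *
      (if corank (border m v) = j then (1 : ℝ) else 0) =
      (if ∀ w, m *ᵥ w = 0 → w ⬝ᵥ v = 0 then ∏ i : Fin k, p i k (v i) else 0) *
        (if corank m + 1 = j then 1 else 0) +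
      (∏ i : Fin k, p i k (v i) - if ∀ w, m *ᵥ w = 0 → w ⬝ᵥ v = 0 then
        ∏ i : Fin k, p i k (v i) else 0) * (if corank m = j + 1 then 1 else 0) := by
    intro v
    by_cases hv : ∀ w, m *ᵥ w = 0 → w ⬝ᵥ v = 0
    · rw [corank_border_of_orthogonal hm hv]
      simp [if_pos hv]
    · have h := corank_border_of_not_orthogonal hm hv
      simp only [if_neg hv, h, zero_mul, sub_zero, zero_add, add_left_inj]
  simp_rw [h1]
  rw [Finset.sum_add_distrib, ← Finset.sum_mul, ← Finset.sum_mul, Finset.sum_sub_distrib,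
    (IsLaw.prod fun i : Fin k => hp i k).sum_eq_one]
  rfl

/-- This has the form of `corankMass_succ` with the uniform rise probability in place of the true
one, so the two differ only through the quantity averaged in `stepError`. -/
theorem chainStep_corankMass (k j : ℕ) :
    chainStep (Fintype.card K) (corankMass p k) j = expect p k fun m =>
      ((Fintype.card K : ℝ) ^ corank m)⁻¹ * (if corank m + 1 = j then 1 else 0) +
      (1 - ((Fintype.card K : ℝ) ^ corank m)⁻¹) * (if corank m = j + 1 then 1 else 0) := by
  rw [expect_add, chainStep]
  congr 1
  · cases j with
    | zero => simpa using (expect_const_mul (p := p) 0 (fun _ : Matrix (Fin k) (Fin k) K => 0)).symm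
    | succ j =>
      rw [if_neg (by omega), corankMass, mul_comm, ← expect_const_mul]
      congr 1
      ext m
      simp only [Nat.add_sub_cancel, add_left_inj]
      split_ifs with h
      · rw [h]
      · simp
  · rw [corankMass, mul_comm, ← expect_const_mul]
    congr 1
    ext m
    split_ifs with h
    · rw [h]
    · simp

/-- The corank of the random matrix is close to the Markov chain of the uniform case. -/
theorem sum_abs_corankMass_succ_sub_le (hp : ∀ i j, IsLaw (p i j)) (k : ℕ) (s : Finset ℕ) :
    ∑ j ∈ s, |corankMass p (k + 1) j - chainStep (Fintype.card K) (corankMass p k) j| ≤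
      2 * stepError p k := by
  rw [stepError, ← expect_const_mul]
  calc _ ≤ ∑ j ∈ s, expect p k (fun m =>
        |orthMass (fun i : Fin k => p i k) m - ((Fintype.card K : ℝ) ^ corank m)⁻¹| *
          ((if corank m + 1 = j then 1 else 0) + if corank m = j + 1 then 1 else 0)) := by
        refine Finset.sum_le_sum fun j _ => ?_
        rw [corankMass_succ hp, chainStep_corankMass, ← expect_sub]
        refine (abs_expect_le hp _).trans (expect_mono hp fun m _ _ => ?_)
        rw [show ∀ a b x y : ℝ, a * x + (1 - a) * y - (b * x + (1 - b) * y) = (a - b) * (x - y) by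
          intros; ring, abs_mul]
        gcongr
        split_ifs <;> simp
    _ ≤ _ := by
        rw [← expect_sum]
        refine expect_mono hp fun m _ _ => ?_
        rw [← Finset.mul_sum, mul_comm, Finset.sum_add_distrib]
        gcongr
        have h1 : ∑ j ∈ s, (if corank m + 1 = j then (1 : ℝ) else 0) ≤ 1 := by
          rw [Finset.sum_ite_eq]; split_ifs <;> simp
        have h2 : ∑ j ∈ s, (if corank m = j + 1 then (1 : ℝ) else 0) ≤ 1 := by
          -- Truncated subtraction is harmless: at corank 0 the left side vanishes, and only an
          -- upper bound is required.
          calc _ ≤ ∑ j ∈ s, (if corank m - 1 = j then (1 : ℝ) else 0) :=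
                Finset.sum_le_sum fun j _ => by
                  split_ifs with h h' h'
                  · exact le_rfl
                  · omega
                  · simp
                  · exact le_rfl
            _ ≤ 1 := by rw [Finset.sum_ite_eq]; split_ifs <;> simp
        linarith

theorem corankMass_nonneg (hp : ∀ i j, IsLaw (p i j)) (k j : ℕ) : 0 ≤ corankMass p k j := by
  rw [← expect_const hp k 0]
  refine expect_mono hp fun m _ _ => ?_
  split_ifs <;> simp

theorem corankMass_eq_zero (hp : ∀ i j, IsLaw (p i j)) {k j : ℕ} (h : ¬Even (j + k)) :
    corankMass p k j = 0 := by
  rw [← expect_const hp k 0]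
  refine expect_congr hp fun m _ he => if_neg ?_
  rintro rfl
  exact h he

theorem corankMass_eq_zero_of_lt (hp : ∀ i j, IsLaw (p i j)) {k j : ℕ} (h : k < j) :
    corankMass p k j = 0 := by
  rw [← expect_const hp k 0]
  refine expect_congr hp fun m _ _ => if_neg ?_
  have : corank m ≤ k := Nat.sub_le _ _
  omega

theorem sum_corankMass (hp : ∀ i j, IsLaw (p i j)) (k : ℕ) :
    ∑ j ∈ Finset.range (k + 1), corankMass p k j = 1 := by
  simp only [corankMass]
  rw [← expect_sum]
  refine Eq.trans ?_ (expect_const hp k 1)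
  congr 1
  ext m
  have : corank m ≤ k := Nat.sub_le _ _
  rw [Finset.sum_ite_eq, if_pos (by simp; omega)]

end RandomAlternating

/-! ### Euler's identities for the generating function of the weights. -/

section EulerIdentity

/-- The weights `q ^ k / ∏_{i=1}^k (q ^ i - 1)`. -/
noncomputable def eulerCoeff (q : ℝ) (k : ℕ) : ℝ :=
  q ^ k / ∏ i ∈ Finset.Icc 1 k, (q ^ i - 1)

variable {q : ℝ}

theorem pow_sub_one_pos (hq : 2 ≤ q) {i : ℕ} (hi : 1 ≤ i) : 0 < q ^ i - 1 := by
  have : 1 < q ^ i := one_lt_pow₀ (by linarith) (by omega)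
  linarith

theorem eulerCoeff_zero : eulerCoeff q 0 = 1 := by simp [eulerCoeff]

theorem eulerCoeff_pos (hq : 2 ≤ q) (k : ℕ) : 0 < eulerCoeff q k :=
  div_pos (by positivity) (Finset.prod_pos fun i hi => pow_sub_one_pos hq (Finset.mem_Icc.1 hi).1)

theorem eulerCoeff_succ (hq : 2 ≤ q) (k : ℕ) :
    eulerCoeff q (k + 1) * (q ^ (k + 1) - 1) = q * eulerCoeff q k := by
  have h1 := (pow_sub_one_pos hq (i := k + 1) (by omega)).ne'
  have hP : ∏ i ∈ Finset.Icc 1 k, (q ^ i - 1) ≠ 0 :=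
    Finset.prod_ne_zero_iff.2 fun i hi => (pow_sub_one_pos hq (Finset.mem_Icc.1 hi).1).ne'
  rw [eulerCoeff, eulerCoeff, Finset.prod_Icc_succ_top (by omega)]
  field_simp
  ring

theorem summable_eulerCoeff_mul_pow (hq : 2 ≤ q) (x : ℝ) :
    Summable fun k => eulerCoeff q k * x ^ k := by
  rcases eq_or_ne x 0 with rfl | hx
  · refine summable_of_ne_finset_zero (s := {0}) fun k hk => ?_
    rw [zero_pow (by simpa using hk), mul_zero]
  refine summable_of_ratio_test_tendsto_lt_one (l := 0) one_pos
    (Filter.Eventually.of_forall fun k => mul_ne_zero (eulerCoeff_pos hq k).ne' (pow_ne_zero _ hx)) ?_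
  have hratio : ∀ k : ℕ, ‖eulerCoeff q (k + 1) * x ^ (k + 1)‖ / ‖eulerCoeff q k * x ^ k‖ =
      q * |x| / (q ^ (k + 1) - 1) := fun k => by
    have h1 := pow_sub_one_pos hq (i := k + 1) (by omega)
    have h2 := eulerCoeff_pos hq k
    have h3 : eulerCoeff q (k + 1) = q * eulerCoeff q k / (q ^ (k + 1) - 1) := by
      rw [eq_div_iff h1.ne', eulerCoeff_succ hq]
    have h4 : 0 < |x| ^ k := by positivity
    rw [norm_mul, norm_mul, Real.norm_of_nonneg (eulerCoeff_pos hq _).le,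
      Real.norm_of_nonneg h2.le, norm_pow, norm_pow, Real.norm_eq_abs, h3, pow_succ |x|]
    field_simp
  simp only [hratio]
  refine Filter.Tendsto.const_div_atTop ?_ _
  refine Filter.tendsto_atTop_add_const_right _ (-1 : ℝ) ?_
  exact (tendsto_pow_atTop_atTop_of_one_lt (by linarith)).comp (Filter.tendsto_add_atTop_nat 1)

/-- The generating function of the weights. -/
noncomputable def eulerSeries (q x : ℝ) : ℝ := ∑' k, eulerCoeff q k * x ^ k

/-- The functional equation is the coefficient recursion `eulerCoeff_succ` summed against powers of
`x`. Evaluating it at special points gives all the sums needed later. -/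
theorem eulerSeries_mul (hq : 2 ≤ q) (x : ℝ) :
    eulerSeries q (q * x) = (1 + q * x) * eulerSeries q x := by
  have h1 := summable_eulerCoeff_mul_pow hq (q * x)
  have h2 := summable_eulerCoeff_mul_pow hq x
  have h3 : eulerSeries q (q * x) - eulerSeries q x = q * x * eulerSeries q x := by
    rw [eulerSeries, eulerSeries, ← h1.tsum_sub h2, ← tsum_mul_left, (h1.sub h2).tsum_eq_zero_add]
    simp only [pow_zero, sub_self, zero_add]
    refine tsum_congr fun k => ?_
    have := eulerCoeff_succ hq k
    linear_combination x ^ (k + 1) * this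
  linarith

theorem eulerSeries_eq_prod_mul (hq : 2 ≤ q) (n : ℕ) :
    eulerSeries q 1 = (∏ i ∈ Finset.range n, (1 + q⁻¹ ^ i)) * eulerSeries q (q⁻¹ ^ n) := by
  have hq0 : q ≠ 0 := by positivity
  induction n with
  | zero => simp
  | succ n ih =>
    rw [ih, Finset.prod_range_succ, mul_assoc]
    have h := eulerSeries_mul hq (q⁻¹ ^ (n + 1))
    rw [pow_succ', mul_inv_cancel_left₀ hq0] at h
    rw [h, pow_succ']

/-- The factor `1 + q * x` vanishes at `x = -1 / q`. Consequently the even and the odd weights have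
the same sum. -/
theorem eulerSeries_neg_one (hq : 2 ≤ q) : eulerSeries q (-1) = 0 := by
  have hq0 : q ≠ 0 := by positivity
  have h := eulerSeries_mul hq (-q⁻¹)
  rw [mul_neg, mul_inv_cancel₀ hq0, add_neg_cancel, zero_mul] at h
  exact h

theorem eulerSeries_self (hq : 2 ≤ q) : eulerSeries q q = (1 + q) * eulerSeries q 1 := by
  simpa using eulerSeries_mul hq 1

theorem eulerSeries_bounds (hq : 2 ≤ q) {x : ℝ} (h0 : 0 ≤ x) (h1 : x ≤ 1) :
    1 ≤ eulerSeries q x ∧ eulerSeries q x ≤ 1 + x * eulerSeries q 1 := by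
  have hs := summable_eulerCoeff_mul_pow hq x
  have hs1 := summable_eulerCoeff_mul_pow hq 1
  have heq : eulerSeries q x = 1 + ∑' k, eulerCoeff q (k + 1) * x ^ (k + 1) := by
    rw [eulerSeries, hs.tsum_eq_zero_add, eulerCoeff_zero, pow_zero, one_mul]
  have hs' := (summable_nat_add_iff 1).2 hs
  have hs1' := (summable_nat_add_iff 1).2 hs1
  have hpos := fun k => (eulerCoeff_pos hq k).le
  constructor
  · rw [heq]
    have : 0 ≤ ∑' k, eulerCoeff q (k + 1) * x ^ (k + 1) :=
      tsum_nonneg fun k => mul_nonneg (hpos _) (by positivity)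
    linarith
  · rw [heq]
    have h2 : ∑' k, eulerCoeff q (k + 1) * x ^ (k + 1) ≤
        ∑' k, x * (eulerCoeff q (k + 1) * 1 ^ (k + 1)) := by
      refine hs'.tsum_le_tsum (fun k => ?_) (hs1'.mul_left x)
      rw [one_pow, mul_one, mul_comm x]
      exact mul_le_mul_of_nonneg_left
        ((pow_le_of_le_one h0 h1 (by omega))) (hpos _)
    have h3 : ∑' k, eulerCoeff q (k + 1) * 1 ^ (k + 1) ≤ eulerSeries q 1 := by
      rw [eulerSeries, hs1.tsum_eq_zero_add, eulerCoeff_zero]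
      linarith
    rw [tsum_mul_left] at h2
    have := mul_le_mul_of_nonneg_left h3 h0
    linarith

/-- A finite form of Euler's theorem on partitions into odd and into distinct parts, with an
explicit remainder product that tends to 1. -/
theorem prod_odd_mul_prod (hq : 2 ≤ q) (n : ℕ) :
    (∏ i ∈ Finset.range n, (1 - q⁻¹ ^ (2 * i + 1))) * ∏ i ∈ Finset.range n, (1 + q⁻¹ ^ (i + 1)) =
      ∏ i ∈ Finset.range n, (1 - q⁻¹ ^ (n + 1 + i)) := by
  have ht1 : q⁻¹ < 1 := inv_lt_one_of_one_lt₀ (by linarith)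
  have ht0 : 0 < q⁻¹ := by positivity
  generalize q⁻¹ = t at *
  induction n with
  | zero => simp
  | succ n ih =>
    have hne : 1 - t ^ (n + 1) ≠ 0 := by
      have : t ^ (n + 1) < 1 := pow_lt_one₀ ht0.le ht1 (by omega)
      linarith
    -- One product of `n + 2` factors is read in two ways: with the first factor split off, and with
    -- the last two split off.
    have h1 : ∏ i ∈ Finset.range (n + 2), (1 - t ^ (n + 1 + i)) =
        (∏ i ∈ Finset.range (n + 1), (1 - t ^ (n + 1 + 1 + i))) * (1 - t ^ (n + 1)) := by
      rw [Finset.prod_range_succ']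
      congr 1
      exact Finset.prod_congr rfl fun i _ => by ring_nf
    have h2 : ∏ i ∈ Finset.range (n + 2), (1 - t ^ (n + 1 + i)) =
        (∏ i ∈ Finset.range n, (1 - t ^ (n + 1 + i))) * (1 - t ^ (2 * n + 1)) *
          ((1 - t ^ (n + 1)) * (1 + t ^ (n + 1))) := by
      rw [Finset.prod_range_succ, Finset.prod_range_succ]
      congr 1
      · congr 3; omega
      · ring
    apply mul_right_cancel₀ hne
    rw [← h1, h2, Finset.prod_range_succ, Finset.prod_range_succ, ← ih]
    ring

theorem tendsto_prod_odd_mul_prod (hq : 2 ≤ q) :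
    Filter.Tendsto (fun n => (∏ i ∈ Finset.range n, (1 - q⁻¹ ^ (2 * i + 1))) *
      ∏ i ∈ Finset.range n, (1 + q⁻¹ ^ (i + 1))) Filter.atTop (𝓝 1) := by
  simp_rw [prod_odd_mul_prod hq]
  have ht1 : q⁻¹ < 1 := inv_lt_one_of_one_lt₀ (by linarith)
  have ht0 : 0 < q⁻¹ := by positivity
  generalize q⁻¹ = t at *
  have hle : ∀ n i : ℕ, t ^ (n + 1 + i) ≤ t ^ n := fun n i =>
    pow_le_pow_of_le_one ht0.le ht1.le (by omega)
  have hle1 : ∀ n : ℕ, t ^ n ≤ 1 := fun n => pow_le_one₀ ht0.le ht1.le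
  refine tendsto_of_tendsto_of_tendsto_of_le_of_le (g := fun n : ℕ => 1 - n * t ^ n)
    (h := fun _ => 1) ?_ tendsto_const_nhds (fun n => ?_) fun n => ?_
  · simpa using (tendsto_self_mul_const_pow_of_lt_one ht0.le ht1).const_sub 1
  -- Bernoulli's inequality.
  · calc 1 - n * t ^ n ≤ (1 - t ^ n) ^ n := by
          have := one_add_mul_le_pow (a := -t ^ n) (by linarith [hle1 n]) n
          simpa [sub_eq_add_neg] using this
      _ = ∏ i ∈ Finset.range n, (1 - t ^ n) := by simp
      _ ≤ _ := Finset.prod_le_prod (fun i _ => by linarith [hle1 n]) fun i _ => by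
          linarith [hle n i]
  · refine Finset.prod_le_one (fun i _ => by linarith [hle1 (n + 1 + i)]) fun i _ => ?_
    have : 0 ≤ t ^ (n + 1 + i) := by positivity
    linarith

end EulerIdentity

/-! ### The limiting laws: normalisation, moments and invariance. -/

section Weights

variable {q : ℕ}

theorem altWeight_eq (q k : ℕ) : altWeight q k =
    (∏' i : ℕ, (1 - ((q : ℝ) ^ (2 * i + 1))⁻¹)) * eulerCoeff q k := rfl

/-- Iterating the functional equation expands `eulerSeries q 1` as the product of the `1 + q⁻¹ ^ i`.
The factor `i = 0` is the 2, and the others cancel the odd product in the limit. -/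
theorem tprod_mul_eulerSeries_one (hq : 2 ≤ q) :
    (∏' i : ℕ, (1 - ((q : ℝ) ^ (2 * i + 1))⁻¹)) * eulerSeries q 1 = 2 := by
  have hq' : (2 : ℝ) ≤ q := by exact_mod_cast hq
  have ht1 : (q : ℝ)⁻¹ < 1 := inv_lt_one_of_one_lt₀ (by linarith)
  have ht0 : (0 : ℝ) < (q : ℝ)⁻¹ := by positivity
  have h1 := (altWeight_multipliable hq).hasProd.tendsto_prod_nat
  simp_rw [← inv_pow] at h1 ⊢
  have h2 : Filter.Tendsto (fun n => eulerSeries (q : ℝ) ((q : ℝ)⁻¹ ^ (n + 1))) Filter.atTop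
      (𝓝 1) := by
    have h3 : Filter.Tendsto (fun n : ℕ => (q : ℝ)⁻¹ ^ (n + 1)) Filter.atTop (𝓝 0) :=
      (tendsto_pow_atTop_nhds_zero_of_lt_one ht0.le ht1).comp (Filter.tendsto_add_atTop_nat 1)
    have hb := fun n : ℕ => eulerSeries_bounds hq' (x := (q : ℝ)⁻¹ ^ (n + 1)) (by positivity)
      (pow_le_one₀ ht0.le ht1.le)
    refine tendsto_of_tendsto_of_tendsto_of_le_of_le tendsto_const_nhds ?_
      (fun n => (hb n).1) (fun n => (hb n).2)
    simpa using (h3.mul_const (eulerSeries (q : ℝ) 1)).const_add 1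
  have h4 := ((tendsto_prod_odd_mul_prod hq').mul h2).const_mul 2
  have h5 := h1.mul_const (eulerSeries (q : ℝ) 1)
  refine (tendsto_nhds_unique h5 (h4.congr fun n => ?_)).trans (by norm_num)
  rw [eulerSeries_eq_prod_mul hq' (n + 1), Finset.prod_range_succ']
  simp only [pow_zero]
  ring

theorem altWeight_nonneg (hq : 2 ≤ q) (k : ℕ) : 0 ≤ altWeight q k := by
  have hq' : (2 : ℝ) ≤ q := by exact_mod_cast hq
  rw [altWeight_eq]
  refine mul_nonneg ?_ (eulerCoeff_pos hq' k).le
  have h1 := tprod_mul_eulerSeries_one hq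
  have h2 := (eulerSeries_bounds hq' zero_le_one le_rfl).1
  by_contra h
  push Not at h
  nlinarith

/-- Detailed balance: the flow from `k + 1` down to `k` equals the flow from `k` up to `k + 1`. -/
theorem altWeight_succ (hq : 2 ≤ q) (k : ℕ) :
    altWeight q (k + 1) * (1 - ((q : ℝ) ^ (k + 1))⁻¹) = altWeight q k * ((q : ℝ) ^ k)⁻¹ := by
  have hq' : (2 : ℝ) ≤ q := by exact_mod_cast hq
  have h := eulerCoeff_succ hq' k
  have hq0 : (q : ℝ) ≠ 0 := by positivity
  rw [altWeight_eq, altWeight_eq, mul_assoc, mul_assoc]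
  have h1 : 1 - ((q : ℝ) ^ (k + 1))⁻¹ = ((q : ℝ) ^ (k + 1) - 1) * ((q : ℝ) ^ (k + 1))⁻¹ := by
    field_simp
  rw [h1, ← mul_assoc (eulerCoeff _ _), h, pow_succ']
  field_simp

/-- The limiting mass function for matrices of size `n`. -/
noncomputable def altParity (q n j : ℕ) : ℝ := if Even (j + n) then altWeight q j else 0

theorem altParity_nonneg (hq : 2 ≤ q) (n j : ℕ) : 0 ≤ altParity q n j := by
  rw [altParity]
  split_ifs
  exacts [altWeight_nonneg hq j, le_rfl]

theorem altParity_le (hq : 2 ≤ q) (n j : ℕ) : altParity q n j ≤ altWeight q j := by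
  rw [altParity]
  split_ifs
  exacts [le_rfl, altWeight_nonneg hq j]

/-- Averaging the series at 1 and, with sign `(-1) ^ n`, at `-1` selects one parity class; the first
carries mass 2 and the second mass 0. -/
theorem hasSum_altParity (hq : 2 ≤ q) (n : ℕ) : HasSum (altParity q n) 1 := by
  have hq' : (2 : ℝ) ≤ q := by exact_mod_cast hq
  have h1 := (summable_eulerCoeff_mul_pow hq' 1).hasSum
  have h2 := (summable_eulerCoeff_mul_pow hq' (-1)).hasSum
  change HasSum _ (eulerSeries q 1) at h1
  change HasSum _ (eulerSeries q (-1)) at h2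
  rw [eulerSeries_neg_one hq'] at h2
  set c := ∏' i : ℕ, (1 - ((q : ℝ) ^ (2 * i + 1))⁻¹) with hc
  have h3 := (h1.add (h2.mul_left ((-1) ^ n))).mul_left (c / 2)
  rw [mul_zero, add_zero, div_mul_eq_mul_div, tprod_mul_eulerSeries_one hq, div_self two_ne_zero]
    at h3
  refine h3.congr_fun ?_
  intro j
  rw [altParity, altWeight_eq, ← hc]
  split_ifs with he
  · have : (-1 : ℝ) ^ n * (-1) ^ j = 1 := by rw [← pow_add, add_comm, he.neg_one_pow]
    linear_combination (-(c / 2) * eulerCoeff q j) * this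
  · have : (-1 : ℝ) ^ n * (-1) ^ j = -1 := by
      rw [← pow_add, add_comm, (Nat.not_even_iff_odd.1 he).neg_one_pow]
    linear_combination (-(c / 2) * eulerCoeff q j) * this

theorem hasSum_altWeight_mul_pow (hq : 2 ≤ q) :
    HasSum (fun j => altWeight q j * (q : ℝ) ^ j) (2 * (1 + q)) := by
  have hq' : (2 : ℝ) ≤ q := by exact_mod_cast hq
  have h1 := (summable_eulerCoeff_mul_pow hq' q).hasSum.mul_left
    (∏' i : ℕ, (1 - ((q : ℝ) ^ (2 * i + 1))⁻¹))
  change HasSum _ (_ * eulerSeries q q) at h1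
  rw [eulerSeries_self hq', mul_left_comm, tprod_mul_eulerSeries_one hq, mul_comm] at h1
  simpa only [altWeight_eq, mul_assoc] using h1

/-- The limiting mass functions are exchanged by the transition operator. -/
theorem chainStep_altParity (hq : 2 ≤ q) (n : ℕ) :
    chainStep q (altParity q n) = altParity q (n + 1) := by
  ext j
  have hq0 : (q : ℝ) ≠ 0 := by positivity
  have h1 : altParity q n (j + 1) * (1 - ((q : ℝ) ^ (j + 1))⁻¹) =
      altParity q (n + 1) j * ((q : ℝ) ^ j)⁻¹ := by
    rw [altParity, altParity, show j + (n + 1) = j + 1 + n by omega]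
    split_ifs
    · exact altWeight_succ hq j
    · simp
  rw [chainStep, h1]
  cases j with
  | zero => simp
  | succ j =>
    have h2 : altParity q n j * ((q : ℝ) ^ j)⁻¹ =
        altParity q (n + 1) (j + 1) * (1 - ((q : ℝ) ^ (j + 1))⁻¹) := by
      rw [altParity, altParity, show j + 1 + (n + 1) = j + n + 2 by omega]
      have he : Even (j + n + 2) ↔ Even (j + n) := by simp [Nat.even_add]
      simp only [he]
      split_ifs
      · exact (altWeight_succ hq j).symm
      · simp
    rw [if_neg (by omega), Nat.add_sub_cancel, h2]
    ring

end Weights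

/-! ### Contraction of the Markov chain. -/

section Chain

variable {q : ℝ}

theorem chainStep_add (f g : ℕ → ℝ) :
    chainStep q (fun j => f j + g j) = fun j => chainStep q f j + chainStep q g j := by
  ext j
  simp only [chainStep]
  split_ifs <;> ring

theorem hasSum_chainStep {f : ℕ → ℝ} {s : ℝ} (hf : HasSum f s) (hq : 1 ≤ q)
    (habs : Summable fun j => |f j|) : HasSum (chainStep q f) s := by
  have hinv : ∀ i : ℕ, 0 ≤ (q ^ i)⁻¹ ∧ (q ^ i)⁻¹ ≤ 1 := fun i =>
    ⟨by positivity, inv_le_one_of_one_le₀ (one_le_pow₀ hq)⟩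
  have h1 : Summable fun i => f i * (q ^ i)⁻¹ := by
    refine Summable.of_norm_bounded habs fun i => ?_
    rw [Real.norm_eq_abs, abs_mul, abs_of_nonneg (hinv i).1]
    exact mul_le_of_le_one_right (abs_nonneg _) (hinv i).2
  have h2 : HasSum (fun j => if j = 0 then 0 else f (j - 1) * (q ^ (j - 1))⁻¹)
      (∑' i, f i * (q ^ i)⁻¹) := by
    rw [← hasSum_nat_add_iff' 1]
    simpa using h1.hasSum
  have h3 : HasSum (fun j => f (j + 1) * (1 - (q ^ (j + 1))⁻¹)) (s - ∑' i, f i * (q ^ i)⁻¹) := by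
    have h4 : HasSum (fun j => f j * (1 - (q ^ j)⁻¹)) (s - ∑' i, f i * (q ^ i)⁻¹) := by
      simpa only [mul_sub, mul_one] using hf.sub h1.hasSum
    rw [← hasSum_nat_add_iff' 1] at h4
    simpa using h4
  have h5 := h2.add h3
  rw [add_sub_cancel] at h5
  exact h5

/-- Weighted bounds pass through the transition operator by duality. -/
theorem summable_mul_abs_chainStep (hq : 1 ≤ q) {W V f : ℕ → ℝ} (hW : ∀ i, 0 ≤ W i)
    (hWV : ∀ i, (q ^ i)⁻¹ * W (i + 1) + (1 - (q ^ i)⁻¹) * W (i - 1) ≤ V i)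
    (hf : Summable fun i => V i * |f i|) :
    Summable (fun j => W j * |chainStep q f j|) ∧
      ∑' j, W j * |chainStep q f j| ≤ ∑' i, V i * |f i| := by
  have hinv : ∀ i : ℕ, 0 ≤ (q ^ i)⁻¹ ∧ (q ^ i)⁻¹ ≤ 1 := fun i =>
    ⟨by positivity, inv_le_one_of_one_le₀ (one_le_pow₀ hq)⟩
  let u : ℕ → ℝ := fun i => (q ^ i)⁻¹ * W (i + 1) * |f i|
  let l : ℕ → ℝ := fun i => (1 - (q ^ i)⁻¹) * W (i - 1) * |f i|
  have hu0 : ∀ i, 0 ≤ u i := fun i =>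
    mul_nonneg (mul_nonneg (hinv i).1 (hW _)) (abs_nonneg _)
  have hl0 : ∀ i, 0 ≤ l i := fun i =>
    mul_nonneg (mul_nonneg (by linarith [(hinv i).2]) (hW _)) (abs_nonneg _)
  have hul : ∀ i, u i + l i ≤ V i * |f i| := fun i => by
    have := mul_le_mul_of_nonneg_right (hWV i) (abs_nonneg (f i))
    simp only [u, l]
    linarith
  have hu : Summable u := Summable.of_nonneg_of_le hu0 (fun i => by linarith [hul i, hl0 i]) hf
  have hl : Summable l := Summable.of_nonneg_of_le hl0 (fun i => by linarith [hul i, hu0 i]) hf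
  have h2 : HasSum (fun j => if j = 0 then 0 else u (j - 1)) (∑' i, u i) := by
    rw [← hasSum_nat_add_iff' 1]
    simpa using hu.hasSum
  have h3 : HasSum (fun j => l (j + 1)) (∑' i, l i) := by
    have h4 := hl.hasSum
    rw [← hasSum_nat_add_iff' 1] at h4
    simpa [l] using h4
  have h4 := h2.add h3
  have hle : ∀ j, W j * |chainStep q f j| ≤ (if j = 0 then 0 else u (j - 1)) + l (j + 1) := by
    intro j
    have h5 : |chainStep q f j| ≤ (if j = 0 then 0 else |f (j - 1)| * (q ^ (j - 1))⁻¹) +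
        |f (j + 1)| * (1 - (q ^ (j + 1))⁻¹) := by
      refine (abs_add_le _ _).trans (add_le_add ?_ ?_)
      · split_ifs
        · simp
        · rw [abs_mul, abs_of_nonneg (hinv _).1]
      · rw [abs_mul, abs_of_nonneg (sub_nonneg.2 (hinv _).2)]
    refine (mul_le_mul_of_nonneg_left h5 (hW j)).trans_eq ?_
    simp only [u, l, Nat.add_sub_cancel]
    split_ifs with h
    · ring
    · rw [Nat.sub_add_cancel (by omega)]; ring
  have hs := Summable.of_nonneg_of_le (fun j => mul_nonneg (hW j) (abs_nonneg _)) hle h4.summable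
  refine ⟨hs, ?_⟩
  calc _ ≤ ∑' j, ((if j = 0 then 0 else u (j - 1)) + l (j + 1)) :=
        hs.tsum_le_tsum hle h4.summable
    _ = ∑' i, (u i + l i) := by rw [h4.tsum_eq, hu.tsum_add hl]
    _ ≤ _ := (hu.add hl).tsum_le_tsum hul hf

/-- The weight `A ^ j` restricted to the values `j ≥ 2`. -/
noncomputable def tailWeight (A : ℝ) (j : ℕ) : ℝ := if j < 2 then 0 else A ^ j

theorem tailWeight_zero (A : ℝ) : tailWeight A 0 = 0 := by simp [tailWeight]

theorem tailWeight_one (A : ℝ) : tailWeight A 1 = 0 := by simp [tailWeight]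

theorem tailWeight_add_two (A : ℝ) (j : ℕ) : tailWeight A (j + 2) = A ^ (j + 2) := by
  simp [tailWeight]

theorem tailWeight_nonneg {A : ℝ} (hA : 0 ≤ A) (j : ℕ) : 0 ≤ tailWeight A j := by
  rw [tailWeight]
  split_ifs <;> positivity

theorem tailWeight_le {A : ℝ} (hA : 0 ≤ A) (j : ℕ) : tailWeight A j ≤ A ^ j := by
  rw [tailWeight]
  split_ifs
  · positivity
  · exact le_rfl

/-- The mass at the values `j ≥ 2`, weighted by `A ^ j`. -/
noncomputable def tailNorm (A : ℝ) (f : ℕ → ℝ) : ℝ := ∑' j, tailWeight A j * |f j|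

/-- Signed measures of total mass zero with exponential decay, living on one parity class. -/
structure IsBalanced (A : ℝ) (n : ℕ) (f : ℕ → ℝ) : Prop where
  summable : Summable fun j => A ^ j * |f j|
  hasSum : HasSum f 0
  parity : ∀ j, ¬Even (j + n) → f j = 0

variable {A : ℝ} {n : ℕ} {f : ℕ → ℝ}

theorem IsBalanced.summable_abs (hf : IsBalanced A n f) (hA : 1 ≤ A) :
    Summable fun j => |f j| :=
  Summable.of_nonneg_of_le (fun _ => abs_nonneg _)
    (fun _ => le_mul_of_one_le_left (abs_nonneg _) (one_le_pow₀ hA)) hf.summable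

theorem IsBalanced.summable_tail (hf : IsBalanced A n f) (hA : 1 ≤ A) :
    Summable fun j => tailWeight A j * |f j| :=
  Summable.of_nonneg_of_le
    (fun j => mul_nonneg (tailWeight_nonneg (by linarith) j) (abs_nonneg _))
    (fun j => mul_le_mul_of_nonneg_right (tailWeight_le (by linarith) j) (abs_nonneg _))
    hf.summable

theorem abs_mul_le_tsum_of_hasSum {g t : ℕ → ℝ} {s c : ℝ} (hg : HasSum g s) (hc : 0 ≤ c)
    (hle : ∀ j, |g j| * c ≤ t j) (ht : Summable t) : |s| * c ≤ ∑' j, t j := by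
  have h := hg.mul_right c
  have h1 := tsum_of_norm_bounded (f := fun j => g j * c) ht.hasSum fun j => by
    rw [norm_mul, Real.norm_eq_abs, Real.norm_of_nonneg hc]
    exact hle j
  rwa [h.tsum_eq, norm_mul, Real.norm_eq_abs, Real.norm_of_nonneg hc] at h1

/-- By parity only one of the values 0 and 1 can carry mass, and by the zero total this mass is
minus that of the values `j ≥ 2`, each weighted at least `A ^ 2`. This is why the norm may ignore 0
and 1. -/
theorem IsBalanced.abs_head_le (hf : IsBalanced A n f) (hA : 1 ≤ A) :
    A ^ 2 * (|f 0| + |f 1|) ≤ tailNorm A f := by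
  have hs : HasSum (fun j => f j - (if j = 0 then f 0 else 0) - if j = 1 then f 1 else 0)
      (-(f 0 + f 1)) := by
    have := (hf.hasSum.sub (hasSum_ite_eq 0 (f 0))).sub (hasSum_ite_eq 1 (f 1))
    rwa [show 0 - f 0 - f 1 = -(f 0 + f 1) by ring] at this
  have h1 : |f 0 + f 1| = |f 0| + |f 1| := by
    by_cases hn : Even n
    · rw [hf.parity 1 (by simp [Nat.even_add, hn])]; simp
    · rw [hf.parity 0 (by simpa using hn)]; simp
  rw [← h1, ← abs_neg, mul_comm]
  refine abs_mul_le_tsum_of_hasSum hs (sq_nonneg A) (fun j => ?_) (hf.summable_tail hA)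
  rcases j with _ | _ | j
  · simp [tailWeight_zero]
  · simp [tailWeight_one]
  · rw [if_neg (by omega), if_neg (by omega), sub_zero, sub_zero, mul_comm, tailWeight_add_two]
    exact mul_le_mul_of_nonneg_right (pow_le_pow_right₀ hA (by omega)) (abs_nonneg _)

theorem IsBalanced.tsum_abs_le (hf : IsBalanced A n f) (hA : 1 ≤ A) :
    ∑' j, |f j| ≤ 2 * tailNorm A f := by
  have h1 := hf.abs_head_le hA
  have h2 := hf.summable_abs hA
  have h3 : |f 0| + |f 1| ≤ tailNorm A f := by
    have : 1 ≤ A ^ 2 := one_le_pow₀ hA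
    nlinarith [abs_nonneg (f 0), abs_nonneg (f 1)]
  have h4 : ∑' j, |f (j + 2)| ≤ tailNorm A f := by
    rw [tailNorm, ← (hf.summable_tail hA).sum_add_tsum_nat_add 2]
    simp only [Finset.sum_range_succ, Finset.sum_range_zero, tailWeight_zero, tailWeight_one,
      tailWeight_add_two, zero_mul, zero_add]
    refine ((summable_nat_add_iff 2).2 h2).tsum_le_tsum (fun j => ?_)
      ((summable_nat_add_iff 2).2 hf.summable)
    exact le_mul_of_one_le_left (abs_nonneg _) (one_le_pow₀ hA)
  rw [← h2.sum_add_tsum_nat_add 2]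
  simp only [Finset.sum_range_succ, Finset.sum_range_zero]
  linarith

/-- From `i ≥ 2`, a step down divides the weight by `A` or kills it, and a step up multiplies it by
`A` but has probability only `A ^ (-2 * i)`: together at most `2 / A`. From 0 no tail is reached.
From 1 the value 2 is reached with probability `1 / q` and weight `A ^ 2 = q`, hence contributes `|f
1|`, which `abs_head_le` bounds by `1 / A` times the norm. -/
theorem IsBalanced.chainStep (hf : IsBalanced A n f) (hA : 1 ≤ A) (hq : q = A ^ 2) :
    IsBalanced A (n + 1) (chainStep q f) ∧
      tailNorm A (_root_.chainStep q f) ≤ 3 / A * tailNorm A f := by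
  have hq1 : 1 ≤ q := hq ▸ one_le_pow₀ hA
  have hA0 : 0 < A := by linarith
  have hinv : ∀ i : ℕ, 0 ≤ (q ^ i)⁻¹ ∧ (q ^ i)⁻¹ ≤ 1 := fun i =>
    ⟨by positivity, inv_le_one_of_one_le₀ (one_le_pow₀ hq1)⟩
  refine ⟨⟨?_, hasSum_chainStep hf.hasSum hq1 (hf.summable_abs hA), ?_⟩, ?_⟩
  · refine (summable_mul_abs_chainStep hq1 (W := fun j => A ^ j)
      (V := fun j => 2 * A * A ^ j) (fun i => by positivity) (fun i => ?_) ?_).1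
    · have h1 : (q ^ i)⁻¹ * A ^ (i + 1) ≤ A * A ^ i := by
        rw [pow_succ']
        exact mul_le_of_le_one_left (by positivity) (hinv i).2
      have h2 : (1 - (q ^ i)⁻¹) * A ^ (i - 1) ≤ A * A ^ i := by
        refine (mul_le_of_le_one_left (by positivity) (by linarith [(hinv i).1])).trans ?_
        rw [← pow_succ']
        exact pow_le_pow_right₀ hA (by omega)
      linarith
    · simpa only [mul_assoc] using hf.summable.mul_left (2 * A)
  · intro j hj
    have h1 : f (j + 1) = 0 := hf.parity _ (by rwa [add_assoc, add_comm 1])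
    rw [_root_.chainStep, h1, zero_mul, add_zero]
    split_ifs with h
    · rfl
    · rw [hf.parity (j - 1), zero_mul]
      intro he
      apply hj
      have := he.add even_two
      rwa [show j - 1 + n + 2 = j + (n + 1) by omega] at this
  · have hV : ∀ i : ℕ, (q ^ i)⁻¹ * tailWeight A (i + 1) +
        (1 - (q ^ i)⁻¹) * tailWeight A (i - 1) ≤
        (if i = 1 then 1 else 0) + 2 / A * tailWeight A i := by
      intro i
      rcases i with _ | _ | i
      · simp [tailWeight_zero, tailWeight_one]
      · rw [zero_add, tailWeight_add_two A 0, Nat.sub_self, tailWeight_zero, tailWeight_one, hq]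
        have : A ≠ 0 := hA0.ne'
        simp [this]
      · have h1 : (q ^ (i + 2))⁻¹ * A ^ (i + 3) ≤ 1 / A * A ^ (i + 2) := by
          rw [hq, ← pow_mul, inv_mul_le_iff₀ (by positivity), one_div, ← div_eq_inv_mul,
            ← mul_div_assoc, le_div_iff₀ hA0, ← pow_succ, ← pow_add]
          exact pow_le_pow_right₀ hA (by omega)
        have h2 : (1 - (q ^ (i + 2))⁻¹) * tailWeight A (i + 1) ≤ 1 / A * A ^ (i + 2) := by
          have h3 : 1 / A * A ^ (i + 2) = A ^ (i + 1) := by rw [pow_succ]; field_simp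
          rw [h3]
          refine (mul_le_of_le_one_left (tailWeight_nonneg hA0.le _)
            (by linarith [(hinv (i + 2)).1])).trans (tailWeight_le hA0.le _)
        have h4 : tailWeight A (i + 3) = A ^ (i + 3) := tailWeight_add_two A (i + 1)
        change (q ^ (i + 2))⁻¹ * tailWeight A (i + 3) + (1 - (q ^ (i + 2))⁻¹) * tailWeight A (i + 1)
          ≤ (if i + 2 = 1 then 1 else 0) + 2 / A * tailWeight A (i + 2)
        rw [if_neg (by omega), zero_add, h4, tailWeight_add_two]
        have : 2 / A * A ^ (i + 2) = 1 / A * A ^ (i + 2) + 1 / A * A ^ (i + 2) := by ring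
        linarith
    have hs1 : HasSum (fun i => (if i = 1 then (1 : ℝ) else 0) * |f i|) |f 1| := by
      have := hasSum_ite_eq 1 |f 1|
      refine this.congr_fun fun i => ?_
      split_ifs with h
      · rw [h, one_mul]
      · rw [zero_mul]
    have hs2 := (hf.summable_tail hA).hasSum.mul_left (2 / A)
    have hs := hs1.add hs2
    have hV' : (fun i => (if i = 1 then (1 : ℝ) else 0) * |f i| +
        2 / A * (tailWeight A i * |f i|)) = fun i =>
        ((if i = 1 then 1 else 0) + 2 / A * tailWeight A i) * |f i| := by
      ext i; ring
    rw [hV'] at hs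
    have h := (summable_mul_abs_chainStep hq1 (W := tailWeight A)
      (tailWeight_nonneg hA0.le) hV hs.summable).2
    rw [hs.tsum_eq] at h
    change tailNorm A _ ≤ |f 1| + 2 / A * tailNorm A f at h
    refine h.trans ?_
    have h1 : |f 1| ≤ 1 / A * tailNorm A f := by
      have h2 := hf.abs_head_le hA
      rw [one_div, ← div_eq_inv_mul, le_div_iff₀ hA0]
      have h3 : A ≤ A ^ 2 := le_self_pow₀ hA two_ne_zero
      nlinarith [abs_nonneg (f 0), abs_nonneg (f 1)]
    have : 3 / A * tailNorm A f = 1 / A * tailNorm A f + 2 / A * tailNorm A f := by ring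
    linarith

theorem summable_abs_chainStep (hq : 1 ≤ q) (hf : Summable fun j => |f j|) :
    Summable (fun j => |chainStep q f j|) ∧ ∑' j, |chainStep q f j| ≤ ∑' j, |f j| := by
  have := summable_mul_abs_chainStep hq (W := fun _ => 1) (V := fun _ => 1) (f := f)
    (fun _ => zero_le_one) (fun i => by simp) (by simpa using hf)
  simpa using this

/-- An approximate trajectory of the transition operator forgets its initial value. -/
theorem tsum_abs_sub_le_of_approx (hA : 1 ≤ A) (hq : q = A ^ 2) {μ π : ℕ → ℕ → ℝ}
    (hπ : ∀ k, π (k + 1) = chainStep q (π k)) {E : ℕ → ℝ}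
    (hμ : ∀ k (s : Finset ℕ), ∑ j ∈ s, |μ (k + 1) j - chainStep q (μ k) j| ≤ E k) (k₀ : ℕ)
    (h₀ : IsBalanced A k₀ fun j => μ k₀ j - π k₀ j) (m : ℕ) :
    ∑' j, |μ (k₀ + m) j - π (k₀ + m) j| ≤
      2 * ((3 / A) ^ m * tailNorm A fun j => μ k₀ j - π k₀ j) +
        ∑ i ∈ Finset.range m, E (k₀ + i) := by
  have hq1 : 1 ≤ q := hq ▸ one_le_pow₀ hA
  -- `g` is the evolved initial difference, which contracts in the tail norm; `h` collects the
  -- errors made on the way, which the operator does not enlarge in `ℓ¹`.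
  have key : ∃ g h : ℕ → ℝ, (∀ j, μ (k₀ + m) j - π (k₀ + m) j = g j + h j) ∧
      IsBalanced A (k₀ + m) g ∧
      tailNorm A g ≤ (3 / A) ^ m * tailNorm A (fun j => μ k₀ j - π k₀ j) ∧
      Summable (fun j => |h j|) ∧ ∑' j, |h j| ≤ ∑ i ∈ Finset.range m, E (k₀ + i) := by
    induction m with
    | zero => exact ⟨_, fun _ => 0, fun j => (add_zero _).symm, h₀, by simp, by simp, by simp⟩
    | succ m ih =>
      obtain ⟨g, h, hgh, hg, hgn, hh, hhn⟩ := ih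
      obtain ⟨hg', hgn'⟩ := hg.chainStep hA hq
      obtain ⟨hh', hhn'⟩ := summable_abs_chainStep hq1 hh
      have he := summable_of_sum_le (fun _ => abs_nonneg _) (hμ (k₀ + m))
      have hen := Real.tsum_le_of_sum_le (fun _ => abs_nonneg _) (hμ (k₀ + m))
      have habs := fun j => abs_add_le (μ (k₀ + m + 1) j - chainStep q (μ (k₀ + m)) j)
        (chainStep q h j)
      have hs := Summable.of_nonneg_of_le (fun j => abs_nonneg _) habs (he.add hh')
      refine ⟨chainStep q g,
        fun j => μ (k₀ + m + 1) j - chainStep q (μ (k₀ + m)) j + chainStep q h j,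
        fun j => ?_, hg', ?_, hs, ?_⟩
      · have h1 : μ (k₀ + m) = fun j => π (k₀ + m) j + (g j + h j) := by
          ext j
          linarith [hgh j]
        have h2 : chainStep q (μ (k₀ + m)) j =
            chainStep q (π (k₀ + m)) j + (chainStep q g j + chainStep q h j) := by
          rw [h1, chainStep_add, chainStep_add]
        simp only [← add_assoc, hπ, h2]
        ring
      · rw [pow_succ', mul_assoc]
        exact hgn'.trans (mul_le_mul_of_nonneg_left hgn (by positivity))
      · rw [Finset.sum_range_succ]
        refine (hs.tsum_le_tsum habs (he.add hh')).trans ?_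
        rw [he.tsum_add hh']
        linarith
  obtain ⟨g, h, hgh, hg, hgn, hh, hhn⟩ := key
  have hga := hg.summable_abs hA
  simp_rw [hgh]
  have habs := fun j => abs_add_le (g j) (h j)
  have hs := Summable.of_nonneg_of_le (fun j => abs_nonneg _) habs (hga.add hh)
  refine (hs.tsum_le_tsum habs (hga.add hh)).trans ?_
  rw [hga.tsum_add hh]
  linarith [hg.tsum_abs_le hA]

end Chain

/-! ### Exponential convergence for independent entries. -/

section IndependentEntries

variable {K : Type*} [Field K] [Fintype K] {p : ℕ → ℕ → K → ℝ}

theorem two_le_card (K : Type*) [Field K] [Fintype K] : 2 ≤ Fintype.card K :=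
  Fintype.one_lt_card

/-- A crude starting bound: the corank is at most `k`, giving `A ^ k`, and for the limiting law `A ^
j ≤ q ^ j / q` when `j ≥ 2`, so its tail is at most `2 * (1 + q) / q ≤ 4`. -/
theorem isBalanced_corankMass_sub (hp : ∀ i j, IsLaw (p i j)) {A : ℝ} (hA : 1 ≤ A)
    (hq : (Fintype.card K : ℝ) = A ^ 2) (k : ℕ) :
    IsBalanced A k (fun j => corankMass p k j - altParity (Fintype.card K) k j) ∧
      tailNorm A (fun j => corankMass p k j - altParity (Fintype.card K) k j) ≤ A ^ k + 4 := by
  have hq2 := two_le_card K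
  have hA0 : 0 < A := by linarith
  set q := Fintype.card K
  have hμ0 := corankMass_nonneg hp k
  have hπ0 := altParity_nonneg hq2 k
  have hw := hasSum_altWeight_mul_pow hq2
  have habs : ∀ j, |corankMass p k j - altParity q k j| ≤ corankMass p k j + altParity q k j :=
    fun j => (abs_sub _ _).trans_eq (by rw [abs_of_nonneg (hμ0 j), abs_of_nonneg (hπ0 j)])
  have hfin : ∀ j ∉ Finset.range (k + 1), A ^ j * corankMass p k j = 0 := fun j hj => by
    rw [corankMass_eq_zero_of_lt hp (by simpa using hj), mul_zero]
  have hμs : Summable fun j => A ^ j * corankMass p k j := summable_of_ne_finset_zero hfin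
  have hμle : ∑' j, A ^ j * corankMass p k j ≤ A ^ k := by
    rw [tsum_eq_sum hfin]
    calc _ ≤ ∑ j ∈ Finset.range (k + 1), A ^ k * corankMass p k j :=
          Finset.sum_le_sum fun j hj => mul_le_mul_of_nonneg_right
            (pow_le_pow_right₀ hA (Nat.lt_succ_iff.1 (Finset.mem_range.1 hj))) (hμ0 j)
      _ = A ^ k := by rw [← Finset.mul_sum, sum_corankMass hp, mul_one]
  have hAq : A ≤ q := hq ▸ le_self_pow₀ hA two_ne_zero
  have hsum : Summable fun j => A ^ j * |corankMass p k j - altParity q k j| := by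
    refine Summable.of_nonneg_of_le (fun j => by positivity) (fun j => ?_)
      (hμs.add hw.summable)
    refine (mul_le_mul_of_nonneg_left (habs j) (by positivity)).trans ?_
    rw [mul_add, mul_comm (altWeight q j)]
    have h1 := altParity_le hq2 k j
    have h2 := altWeight_nonneg hq2 j
    have h3 := hπ0 j
    gcongr
  have hbal : IsBalanced A k (fun j => corankMass p k j - altParity q k j) := by
    refine ⟨hsum, ?_, fun j hj => ?_⟩
    · have h1 : HasSum (corankMass p k) 1 := by
        rw [← sum_corankMass hp k]
        exact hasSum_sum_of_ne_finset_zero fun j hj =>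
          corankMass_eq_zero_of_lt hp (by simpa using hj)
      simpa using h1.sub (hasSum_altParity hq2 k)
    · rw [corankMass_eq_zero hp hj, altParity, if_neg hj, sub_zero]
  refine ⟨hbal, ?_⟩
  have hw2 := hw.mul_left (1 / (q : ℝ))
  have hq0 : (0 : ℝ) < q := by positivity
  calc _ ≤ ∑' j, (A ^ j * corankMass p k j + 1 / (q : ℝ) * (altWeight q j * (q : ℝ) ^ j)) := by
        refine (hbal.summable_tail hA).tsum_le_tsum (fun j => ?_) (hμs.add hw2.summable)
        refine (mul_le_mul_of_nonneg_left (habs j) (tailWeight_nonneg hA0.le j)).trans ?_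
        rw [mul_add]
        refine add_le_add (mul_le_mul_of_nonneg_right (tailWeight_le hA0.le j) (hμ0 j)) ?_
        have h1 := altParity_le hq2 k j
        have h2 := altWeight_nonneg hq2 j
        rw [mul_left_comm, mul_comm]
        refine mul_le_mul h1 ?_ (tailWeight_nonneg hA0.le j) h2
        rcases j with _ | _ | j
        · rw [tailWeight_zero]; positivity
        · rw [tailWeight_one]; positivity
        · rw [tailWeight_add_two, one_div, ← div_eq_inv_mul, le_div_iff₀ hq0, hq, ← pow_mul,
            ← pow_add]
          exact pow_le_pow_right₀ hA (by omega)
    _ = ∑' j, A ^ j * corankMass p k j + 1 / (q : ℝ) * (2 * (1 + q)) := by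
        rw [hμs.tsum_add hw2.summable, hw2.tsum_eq]
    _ ≤ A ^ k + 4 := by
        refine add_le_add hμle ?_
        have : (2 : ℝ) ≤ q := by exact_mod_cast hq2
        rw [one_div, inv_mul_le_iff₀ hq0]
        linarith

theorem summable_abs_corankMass_sub (hp : ∀ i j, IsLaw (p i j)) (k : ℕ) :
    Summable fun j => |corankMass p k j - altParity (Fintype.card K) k j| := by
  have hq : (1 : ℝ) ≤ Fintype.card K := by exact_mod_cast Fintype.card_pos (α := K)
  have h1 : 1 ≤ √(Fintype.card K : ℝ) := Real.one_le_sqrt.2 hq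
  exact (isBalanced_corankMass_sub hp h1 (Real.sq_sqrt (by linarith)).symm k).1.summable_abs h1

theorem tsum_abs_corankMass_sub_le_two (hp : ∀ i j, IsLaw (p i j)) (k : ℕ) :
    ∑' j, |corankMass p k j - altParity (Fintype.card K) k j| ≤ 2 := by
  have h1 : HasSum (corankMass p k) 1 := by
    rw [← sum_corankMass hp k]
    exact hasSum_sum_of_ne_finset_zero fun j hj =>
      corankMass_eq_zero_of_lt hp (by simpa using hj)
  have h2 := h1.add (hasSum_altParity (two_le_card K) k)
  refine ((summable_abs_corankMass_sub hp k).tsum_le_tsum (fun j => ?_) h2.summable).trans ?_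
  · refine (abs_sub _ _).trans_eq ?_
    rw [abs_of_nonneg (corankMass_nonneg hp k j),
      abs_of_nonneg (altParity_nonneg (two_le_card K) k j)]
  · rw [h2.tsum_eq]; norm_num

theorem tsum_abs_corankMass_sub_le (hp : ∀ i j, IsLaw (p i j)) {A : ℝ} (hA : 1 ≤ A)
    (hq : (Fintype.card K : ℝ) = A ^ 2) (k m : ℕ) :
    ∑' j, |corankMass p (k + m) j - altParity (Fintype.card K) (k + m) j| ≤
      2 * ((3 / A) ^ m * (A ^ k + 4)) + ∑ i ∈ Finset.range m, 2 * stepError p (k + i) := by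
  obtain ⟨h1, h2⟩ := isBalanced_corankMass_sub hp hA hq k
  refine (tsum_abs_sub_le_of_approx (q := Fintype.card K) hA hq
    (fun k => (chainStep_altParity (two_le_card K) k).symm)
    (sum_abs_corankMass_succ_sub_le hp) k h1 m).trans ?_
  have : 0 ≤ (3 / A) ^ m := by positivity
  gcongr

/-- Exponential convergence of the corank for independent entries, most of them near uniform. -/
theorem tsum_abs_corankMass_sub_le_pow (hp : ∀ i j, IsLaw (p i j)) {C u : ℝ} (hC : 1 ≤ C)
    (hu : 100 * C ≤ u) (hq : (Fintype.card K : ℝ) = u ^ 200) {N : ℕ → Finset ℕ}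
    (hN : ∀ i j, i ∈ N j ↔ j ∈ N i)
    (hτ : ∀ i j, i < j → i ∉ N j → ∀ a, p i j a ≤ C / Fintype.card K) {n b : ℕ}
    (hb : ∀ j, (N j).card ≤ b) (hbn : 100 * b ≤ n) (hn : 1 ≤ n) :
    ∑' j, |corankMass p n j - altParity (Fintype.card K) n j| ≤ 2 * (u⁻¹) ^ n := by
  have hu100 : 100 ≤ u := by linarith
  have hu0 : 0 < u := by linarith
  have hu1 : 1 ≤ u := by linarith
  have hCu : C ≤ u := by linarith
  obtain ⟨t, ht⟩ : ∃ t, t = u⁻¹ := ⟨_, rfl⟩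
  have ht0 : 0 < t := by rw [ht]; positivity
  have ht1 : t ≤ 1 / 100 := by
    rw [ht, one_div]; exact inv_anti₀ (by norm_num) hu100
  have hut : u * t = 1 := by rw [ht]; exact mul_inv_cancel₀ hu0.ne'
  have hcancel : ∀ a c d : ℕ, a + d ≤ c → u ^ a * t ^ c ≤ t ^ d := fun a c d h => by
    obtain ⟨e, rfl⟩ := Nat.exists_eq_add_of_le h
    rw [show a + d + e = a + (d + e) by ring, pow_add t a, ← mul_assoc, ← mul_pow, hut, one_pow,
      one_mul]
    exact pow_le_pow_of_le_one ht0.le (by linarith) (by omega)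
  have hA : (1 : ℝ) ≤ u ^ 100 := one_le_pow₀ hu1
  have h3A : 3 / u ^ 100 ≤ t ^ 99 := by
    rw [div_le_iff₀ (by positivity)]
    calc (3 : ℝ) ≤ u := by linarith
      _ = t ^ 99 * u ^ 100 := by
        rw [pow_succ u 99, ← mul_assoc, ← mul_pow, mul_comm t, hut, one_pow, one_mul]
  have hτq : C / (Fintype.card K : ℝ) ≤ t ^ 199 := by
    rw [hq, div_le_iff₀ (by positivity)]
    calc C ≤ u := hCu
      _ = t ^ 199 * u ^ 200 := by
        rw [pow_succ u 199, ← mul_assoc, ← mul_pow, mul_comm t, hut, one_pow, one_mul]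
  have hqA : (Fintype.card K : ℝ) = (u ^ 100) ^ 2 := by rw [hq, ← pow_mul]
  rw [← ht]
  -- Below 100 the condition `100 * b ≤ n` leaves no exceptional positions, and the chain can be run
  -- from size 0 with the error `C / q` per step.
  rcases lt_or_ge n 100 with hn100 | hn100
  · have hNe : ∀ j, N j = ∅ := fun j => by
      have := hb j
      exact Finset.card_eq_zero.1 (by omega)
    have h1 := tsum_abs_corankMass_sub_le hp hA hqA 0 n
    rw [zero_add] at h1
    refine h1.trans ?_
    have h2 : ∑ i ∈ Finset.range n, 2 * stepError p (0 + i) ≤ 200 * (t ^ n * t ^ 2) := by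
      calc _ ≤ ∑ i ∈ Finset.range n, 2 * t ^ 199 := by
            refine Finset.sum_le_sum fun i _ => mul_le_mul_of_nonneg_left ?_ (by norm_num)
            refine (stepError_le_of_free hp hC (fun i j hij a => hτ i j hij ?_ a) _).trans hτq
            rw [hNe]; simp
        _ = (2 * n) * t ^ 199 := by simp; ring
        _ ≤ 200 * (t ^ n * t ^ 2) := by
            rw [← pow_add]
            refine mul_le_mul ?_ (pow_le_pow_of_le_one ht0.le (by linarith) (by omega))
              (by positivity) (by norm_num)
            have : (n : ℝ) ≤ 100 := by exact_mod_cast hn100.le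
            linarith
    have h3 : (3 / u ^ 100) ^ n ≤ t ^ n * t := by
      refine (pow_le_pow_left₀ (by positivity) h3A n).trans ?_
      rw [← pow_mul, ← pow_succ]
      exact pow_le_pow_of_le_one ht0.le (by linarith) (by omega)
    rw [pow_zero]
    have h4 : 0 < t ^ n := by positivity
    have h5 : t ^ n * t ≤ t ^ n * (1 / 100) := mul_le_mul_of_nonneg_left ht1 h4.le
    have h6 : t ^ n * t ^ 2 ≤ t ^ n * (1 / 10000) :=
      mul_le_mul_of_nonneg_left (by nlinarith) h4.le
    linarith
  -- The starting size is a fixed proportion of `n`: small enough for the contraction over `m` steps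
  -- to beat `A ^ k`, large enough for `(C / q) ^ (k - 1 - b)` to beat the number of bad vectors.
  · obtain ⟨k, hk⟩ : ∃ k, k = (n + 3) / 4 := ⟨_, rfl⟩
    obtain ⟨m, rfl⟩ : ∃ m, n = k + m := ⟨n - k, by omega⟩
    refine (tsum_abs_corankMass_sub_le hp hA hqA k m).trans ?_
    -- The threshold is `δ = t ^ (2 * n)`; the spare factor `t ^ n` absorbs the sum over the steps.
    have hT : 0 < t ^ (2 * (k + m)) := by positivity
    have h1 : (3 / u ^ 100) ^ m * ((u ^ 100) ^ k + 4) ≤ 5 * t ^ (2 * (k + m)) := by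
      calc (3 / u ^ 100) ^ m * ((u ^ 100) ^ k + 4) ≤ (t ^ 99) ^ m * (5 * (u ^ 100) ^ k) := by
            refine mul_le_mul (pow_le_pow_left₀ (by positivity) h3A m) ?_ (by positivity)
              (by positivity)
            have : 1 ≤ (u ^ 100) ^ k := one_le_pow₀ hA
            linarith
        _ = 5 * (u ^ (100 * k) * t ^ (99 * m)) := by rw [← pow_mul, ← pow_mul]; ring
        _ ≤ 5 * t ^ (2 * (k + m)) := by
            refine mul_le_mul_of_nonneg_left (hcancel _ _ _ (by omega)) (by norm_num)
    have h2 : ∀ i, stepError p (k + i) ≤ 2 * t ^ (2 * (k + m)) := by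
      intro i
      have hCq : C ≤ Fintype.card K := by
        rw [hq]; exact hCu.trans (le_self_pow₀ hu1 (by norm_num))
      refine (stepError_le hp hC hCq hN hτ hb (k + i) hT).trans ?_
      have h3 : C ^ (k + i) * (Fintype.card K : ℝ) ^ b / (t ^ (2 * (k + m))) ^ 2 *
          (C / Fintype.card K) ^ (k + i - 1 - b) ≤ t ^ (2 * (k + m)) := by
        have h4 : 1 / (t ^ (2 * (k + m))) ^ 2 = u ^ (4 * (k + m)) := by
          rw [ht, ← pow_mul, inv_pow, one_div, inv_inv]; congr 1; ring
        calc _ = C ^ (k + i) * (Fintype.card K : ℝ) ^ b * (1 / (t ^ (2 * (k + m))) ^ 2) *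
              (C / Fintype.card K) ^ (k + i - 1 - b) := by ring
          _ ≤ u ^ (k + i) * (u ^ 200) ^ b * u ^ (4 * (k + m)) * (t ^ 199) ^ (k + i - 1 - b) := by
              rw [h4, hq]
              rw [hq] at hτq
              gcongr
          _ = u ^ (k + i + 200 * b + 4 * (k + m)) * t ^ (199 * (k + i - 1 - b)) := by
              rw [← pow_mul, ← pow_mul, pow_add u (k + i + 200 * b), pow_add u (k + i)]
          _ ≤ _ := hcancel _ _ _ (by omega)
      linarith
    have h3 : ∑ i ∈ Finset.range m, 2 * stepError p (k + i) ≤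
        4 * m * t ^ (2 * (k + m)) := by
      calc _ ≤ ∑ i ∈ Finset.range m, 2 * (2 * t ^ (2 * (k + m))) :=
            Finset.sum_le_sum fun i _ => mul_le_mul_of_nonneg_left (h2 i) (by norm_num)
        _ = _ := by rw [Finset.sum_const, Finset.card_range, nsmul_eq_mul]; ring
    have h4 : 2 * (5 * t ^ (2 * (k + m))) + 4 * m * t ^ (2 * (k + m)) ≤ 2 * t ^ (k + m) := by
      have h5 : (5 + 2 * m : ℝ) * t ^ (k + m) ≤ 1 := by
        rw [ht, inv_pow, ← div_eq_mul_inv, div_le_one (by positivity)]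
        have h6 := one_add_mul_le_pow (a := u - 1) (by linarith) (k + m)
        have h7 : (1 : ℝ) ≤ k + m := by exact_mod_cast hn
        have h8 : (0 : ℝ) ≤ k := by positivity
        push_cast at h6
        rw [add_sub_cancel] at h6
        nlinarith
      have h9 : t ^ (2 * (k + m)) = t ^ (k + m) * t ^ (k + m) := by rw [two_mul, pow_add]
      have h10 : 0 < t ^ (k + m) := by positivity
      rw [h9]
      nlinarith
    linarith

end IndependentEntries

/-! ### The recursive expectation as an explicit sum. -/

section SumOverMatrices

variable {K : Type*} [Field K] [Fintype K]

open Classical in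
/-- The expectation as a sum over alternating matrices. -/
theorem expect_eq_sum (p : ℕ → ℕ → K → ℝ) (k : ℕ) (f : Matrix (Fin k) (Fin k) K → ℝ) :
    expect p k f = ∑ A : Matrix (Fin k) (Fin k) K with IsAlternating A,
      (∏ j : Fin k, ∏ i : Fin k, if i < j then p i j (A i j) else 1) * f A := by
  induction k with
  | zero =>
    rw [Finset.filter_true_of_mem fun A _ => ⟨fun i => i.elim0, fun i => i.elim0⟩]
    simp only [expect, Finset.prod_of_isEmpty, one_mul]
    exact (Fintype.sum_subsingleton _ 0).symm
  | succ k ih =>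
    rw [expect, ih]
    simp_rw [Finset.mul_sum]
    rw [← Finset.sum_product']
    refine Finset.sum_bij' (fun x _ => border x.1 x.2)
      (fun A _ => (A.submatrix Fin.castSucc Fin.castSucc, fun i => A i.castSucc (Fin.last k)))
      ?_ ?_ ?_ ?_ ?_
    · rintro ⟨m, v⟩ h
      simp only [Finset.mem_product, Finset.mem_filter, Finset.mem_univ, true_and, and_true] at h ⊢
      exact h.border v
    · intro A h
      simp only [Finset.mem_product, Finset.mem_filter, Finset.mem_univ, true_and, and_true] at h ⊢
      exact ⟨fun i => h.diag _, fun i j => h.skew _ _⟩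
    · rintro ⟨m, v⟩ -
      simp only [border_castSucc_last, Prod.mk.injEq, and_true]
      ext i j
      simp
    · intro A h
      simp only [Finset.mem_filter, Finset.mem_univ, true_and] at h
      ext i j
      induction i using Fin.lastCases <;> induction j using Fin.lastCases <;> simp
      · exact (h.diag _).symm
      · exact (h.skew _ _).symm
    · rintro ⟨m, v⟩ -
      rw [← mul_assoc]
      congr 1
      rw [Fin.prod_univ_castSucc]
      congr 1
      · refine Finset.prod_congr rfl fun j _ => ?_
        rw [Fin.prod_univ_castSucc]
        simp [(Fin.castSucc_lt_last j).not_gt]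
      · rw [Fin.prod_univ_castSucc]
        simp [Fin.castSucc_lt_last]

end SumOverMatrices

/-! ### Conditioning on the arbitrary entries. -/

section CondLaw

variable {K Ω : Type*} [Fintype K] [MeasurableSpace Ω] {n : ℕ}

open Classical in
/-- The laws of the entries conditionally on the values `y` at the positions in the index sets. -/
noncomputable def condLaw (μ : Measure Ω) (M : Ω → Matrix (Fin n) (Fin n) K)
    (F : Fin n → Finset (Fin n)) (y : ArbPos F → K) (i j : ℕ) (a : K) : ℝ :=
  if h : ∃ (hi : i < n) (hj : j < n), (⟨i, hi⟩ : Fin n) < ⟨j, hj⟩ then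
    if h' : (⟨j, h.2.1⟩ : Fin n) ∈ F ⟨i, h.1⟩ then
      if y ⟨(⟨i, h.1⟩, ⟨j, h.2.1⟩), h.2.2, h'⟩ = a then 1 else 0
    else μ.real {ω | M ω ⟨i, h.1⟩ ⟨j, h.2.1⟩ = a}
  -- The uniform law as default keeps every pair of natural indices near uniform unless it is
  -- exceptional.
  else (Fintype.card K : ℝ)⁻¹

variable {μ : Measure Ω} {M : Ω → Matrix (Fin n) (Fin n) K} {F : Fin n → Finset (Fin n)}

theorem condLaw_of_free (y : ArbPos F → K) {i j : Fin n} (hij : i < j) (hF : j ∉ F i) (a : K) :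
    condLaw μ M F y i j a = μ.real {ω | M ω i j = a} := by
  rw [condLaw, dif_pos ⟨i.2, j.2, hij⟩, dif_neg hF]

open Classical in
theorem condLaw_of_arb (y : ArbPos F → K) {i j : Fin n} (hij : i < j) (hF : j ∈ F i) (a : K) :
    condLaw μ M F y i j a = if y ⟨(i, j), hij, hF⟩ = a then 1 else 0 := by
  rw [condLaw, dif_pos ⟨i.2, j.2, hij⟩, dif_pos hF]

theorem isLaw_measureReal {S : Type*} [Fintype S] [MeasurableSpace S] [MeasurableSingletonClass S]
    [IsProbabilityMeasure μ] {X : Ω → S} (hX : Measurable X) :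
    IsLaw fun a => μ.real {ω | X ω = a} := by
  refine ⟨fun a => measureReal_nonneg, ?_⟩
  have h := sum_measureReal_preimage_singleton (μ := μ) Finset.univ (f := X)
    fun a _ => hX (measurableSet_singleton a)
  rw [Finset.coe_univ, Set.preimage_univ, probReal_univ] at h
  exact h

/-- The conditional weight of a matrix factors over the free and the other positions. -/
theorem prod_condLaw (y : ArbPos F → K) (A : Matrix (Fin n) (Fin n) K) [Decidable
    ((fun s : ArbPos F => A s.1.1 s.1.2) = y)] :
    (∏ j : Fin n, ∏ i : Fin n, if i < j then condLaw μ M F y i j (A i j) else 1) =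
      (∏ s : FreePos F, μ.real {ω | M ω s.1.1 s.1.2 = A s.1.1 s.1.2}) *
        if (fun s : ArbPos F => A s.1.1 s.1.2) = y then 1 else 0 := by
  classical
  rw [Finset.prod_comm, ← Fintype.prod_prod_type' (f := fun i j : Fin n =>
    if i < j then condLaw μ M F y i j (A i j) else 1)]
  have hsplit : ∀ x : Fin n × Fin n,
      (if x.1 < x.2 then condLaw μ M F y x.1 x.2 (A x.1 x.2) else 1) =
      (if x.1 < x.2 ∧ x.2 ∉ F x.1 then condLaw μ M F y x.1 x.2 (A x.1 x.2) else 1) *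
      (if x.1 < x.2 ∧ x.2 ∈ F x.1 then condLaw μ M F y x.1 x.2 (A x.1 x.2) else 1) := by
    intro x
    by_cases h1 : x.1 < x.2 <;> by_cases h2 : x.2 ∈ F x.1 <;> simp [h1, h2]
  simp_rw [hsplit]
  rw [Finset.prod_mul_distrib, ← Finset.prod_filter, ← Finset.prod_filter]
  congr 1
  · rw [Finset.prod_subtype _ (p := fun x : Fin n × Fin n => x.1 < x.2 ∧ x.2 ∉ F x.1) (by simp)]
    exact Finset.prod_congr rfl fun s _ => condLaw_of_free y s.2.1 s.2.2 _
  · rw [Finset.prod_subtype _ (p := fun x : Fin n × Fin n => x.1 < x.2 ∧ x.2 ∈ F x.1) (by simp)]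
    calc _ = ∏ s : ArbPos F, (if y s = A s.1.1 s.1.2 then (1 : ℝ) else 0) :=
          Finset.prod_congr rfl fun s _ => condLaw_of_arb y s.2.1 s.2.2 _
      _ = _ := by
          rw [Finset.prod_ite_zero]
          simp only [Finset.prod_const_one, Finset.mem_univ, true_implies]
          refine if_congr ⟨fun h => ?_, fun h s => ?_⟩ rfl rfl
          · ext s
            exact (h s).symm
          · rw [← h]

variable [Field K] [MeasurableSpace K]

theorem isLaw_condLaw [MeasurableSingletonClass K] [IsProbabilityMeasure μ] {C : ℝ}
    (hM : IsNearUniformAlternating C F μ M) (y : ArbPos F → K) (i j : ℕ) :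
    IsLaw (condLaw μ M F y i j) := by
  classical
  by_cases h : ∃ (hi : i < n) (hj : j < n), (⟨i, hi⟩ : Fin n) < ⟨j, hj⟩
  · obtain ⟨hi, hj, hij⟩ := h
    by_cases h' : (⟨j, hj⟩ : Fin n) ∈ F ⟨i, hi⟩
    · have : condLaw μ M F y i j = fun a => if y ⟨(⟨i, hi⟩, ⟨j, hj⟩), hij, h'⟩ = a then 1 else 0 :=
        funext fun a => condLaw_of_arb y hij h' a
      rw [this]
      refine ⟨fun a => ?_, by simp⟩
      split_ifs <;> simp
    · have : condLaw μ M F y i j = fun a => μ.real {ω | M ω ⟨i, hi⟩ ⟨j, hj⟩ = a} :=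
        funext fun a => condLaw_of_free y hij h' a
      rw [this]
      exact isLaw_measureReal (hM.measurable _ _)
  · have : condLaw μ M F y i j = fun _ => (Fintype.card K : ℝ)⁻¹ := by
      ext a
      rw [condLaw, dif_neg h]
    rw [this]
    exact ⟨fun a => by positivity, by simp⟩

theorem condLaw_le {C : ℝ} (hC : 1 ≤ C) (hM : IsNearUniformAlternating C F μ M)
    (y : ArbPos F → K) (i j : ℕ)
    (hF : ∀ (hi : i < n) (hj : j < n), (⟨j, hj⟩ : Fin n) ∉ F ⟨i, hi⟩) (a : K) :
    condLaw μ M F y i j a ≤ C / Fintype.card K := by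
  by_cases h : ∃ (hi : i < n) (hj : j < n), (⟨i, hi⟩ : Fin n) < ⟨j, hj⟩
  · obtain ⟨hi, hj, hij⟩ := h
    exact (condLaw_of_free y hij (hF hi hj) a).trans_le (hM.nearUniform _ _ hij (hF hi hj) a)
  · rw [condLaw, dif_neg h, ← one_div]
    gcongr

theorem IsNearUniformAlternating.isAlternating {C : ℝ} (hM : IsNearUniformAlternating C F μ M)
    (ω : Ω) : IsAlternating (M ω) := by
  refine ⟨hM.diag ω, fun i j => ?_⟩
  rcases lt_trichotomy i j with h | rfl | h
  · exact hM.antisymm ω i j h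
  · rw [hM.diag, neg_zero]
  · rw [hM.antisymm ω j i h, neg_neg]

/-- Only the `y` read off from `A` contributes. For it the event splits into the free and the
arbitrary entries, which are independent, and the free part splits further. -/
theorem measureReal_eq_sum_condLaw [MeasurableSingletonClass K] {C : ℝ}
    (hM : IsNearUniformAlternating C F μ M) [IsProbabilityMeasure μ]
    {A : Matrix (Fin n) (Fin n) K} (hA : IsAlternating A) :
    μ.real {ω | M ω = A} = ∑ y : ArbPos F → K,
      μ.real {ω | (fun s : ArbPos F => M ω s.1.1 s.1.2) = y} *
        ∏ j : Fin n, ∏ i : Fin n, if i < j then condLaw μ M F y i j (A i j) else 1 := by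
  classical
  simp_rw [prod_condLaw, ← mul_assoc, mul_ite, mul_one, mul_zero]
  rw [Finset.sum_ite_eq Finset.univ, if_pos (Finset.mem_univ _)]
  have h1 : {ω | M ω = A} =
      ((fun (ω : Ω) (s : FreePos F) => M ω s.1.1 s.1.2) ⁻¹' {fun s => A s.1.1 s.1.2}) ∩
      ((fun (ω : Ω) (s : ArbPos F) => M ω s.1.1 s.1.2) ⁻¹' {fun s => A s.1.1 s.1.2}) := by
    ext ω
    simp only [Set.mem_ofPred_eq, Set.mem_inter_iff, Set.mem_preimage, Set.mem_singleton_iff]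
    constructor
    · rintro rfl
      exact ⟨rfl, rfl⟩
    · rintro ⟨hf, ha⟩
      refine (hM.isAlternating ω).ext_of_lt hA fun i j hij => ?_
      by_cases h : j ∈ F i
      · exact congrFun ha ⟨(i, j), hij, h⟩
      · exact congrFun hf ⟨(i, j), hij, h⟩
  have h2 : (fun (ω : Ω) (s : FreePos F) => M ω s.1.1 s.1.2) ⁻¹' {fun s => A s.1.1 s.1.2} =
      ⋂ s ∈ (Finset.univ : Finset (FreePos F)),
        (fun ω => M ω s.1.1 s.1.2) ⁻¹' {A s.1.1 s.1.2} := by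
    ext ω
    simp [funext_iff]
  rw [h1, measureReal_def, hM.indep_arb.measure_inter_preimage_eq_mul _ _
    (measurableSet_singleton _) (measurableSet_singleton _), ENNReal.toReal_mul, h2,
    hM.indep_free.measure_inter_preimage_eq_mul Finset.univ
      (fun s _ => measurableSet_singleton _), ENNReal.toReal_prod, mul_comm]
  rfl

/-- The law of the corank is a mixture of the laws for independent entries. -/
theorem massFn_corank_eq_sum [MeasurableSingletonClass K] {C : ℝ}
    (hM : IsNearUniformAlternating C F μ M) [IsProbabilityMeasure μ] (k : ℕ) :
    massFn μ (fun ω => corank (M ω)) k = ∑ y : ArbPos F → K,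
      μ.real {ω | (fun s : ArbPos F => M ω s.1.1 s.1.2) = y} *
        corankMass (condLaw μ M F y) n k := by
  classical
  have hmeas : ∀ A : Matrix (Fin n) (Fin n) K, MeasurableSet (M ⁻¹' {A}) := by
    intro A
    have : M ⁻¹' {A} = ⋂ i, ⋂ j, (fun ω => M ω i j) ⁻¹' {A i j} := by
      ext ω
      simp [← Matrix.ext_iff]
    rw [this]
    exact MeasurableSet.iInter fun i => MeasurableSet.iInter fun j =>
      hM.measurable i j (measurableSet_singleton _)
  have h1 := sum_measureReal_preimage_singleton (μ := μ) (f := M)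
    (Finset.univ.filter fun A => IsAlternating A ∧ corank A = k) fun A _ => hmeas A
  have h2 : {ω | corank (M ω) = k} =
      M ⁻¹' ↑(Finset.univ.filter fun A : Matrix (Fin n) (Fin n) K =>
        IsAlternating A ∧ corank A = k) := by
    ext ω
    simp [hM.isAlternating ω]
  rw [massFn, h2, ← h1]
  simp_rw [corankMass, expect_eq_sum, Finset.mul_sum]
  rw [Finset.sum_comm, ← Finset.filter_filter, Finset.sum_filter]
  refine Finset.sum_congr rfl fun A hA => ?_
  split_ifs with h
  · simp only [mul_one]
    exact measureReal_eq_sum_condLaw hM (Finset.mem_filter.1 hA).2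
  · simp

/-- Convexity of the distance, applied to the mixture; the limiting law is the same for every `y`.
-/
theorem tvDist_massFn_corank_le [MeasurableSingletonClass K] {C : ℝ}
    (hM : IsNearUniformAlternating C F μ M) [IsProbabilityMeasure μ] {B : ℝ}
    (hB : ∀ y, ∑' j, |corankMass (condLaw μ M F y) n j - altParity (Fintype.card K) n j| ≤ 2 * B) :
    tvDist (massFn μ fun ω => corank (M ω)) (altParity (Fintype.card K) n) ≤ B := by
  have hlaw : IsLaw fun y : ArbPos F → K =>
      μ.real {ω | (fun s : ArbPos F => M ω s.1.1 s.1.2) = y} :=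
    isLaw_measureReal (measurable_pi_lambda _ fun s => hM.measurable _ _)
  have hs := fun y => summable_abs_corankMass_sub (isLaw_condLaw hM y) n
  have hle : ∀ j, |massFn μ (fun ω => corank (M ω)) j - altParity (Fintype.card K) n j| ≤
      ∑ y : ArbPos F → K, μ.real {ω | (fun s : ArbPos F => M ω s.1.1 s.1.2) = y} *
        |corankMass (condLaw μ M F y) n j - altParity (Fintype.card K) n j| := by
    intro j
    have h1 : altParity (Fintype.card K) n j = ∑ y : ArbPos F → K,
        μ.real {ω | (fun s : ArbPos F => M ω s.1.1 s.1.2) = y} *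
          altParity (Fintype.card K) n j := by
      rw [← Finset.sum_mul, hlaw.sum_eq_one, one_mul]
    rw [massFn_corank_eq_sum hM]
    conv_lhs => rw [h1]
    rw [← Finset.sum_sub_distrib]
    refine (Finset.abs_sum_le_sum_abs _ _).trans_eq (Finset.sum_congr rfl fun y _ => ?_)
    rw [← mul_sub, abs_mul, abs_of_nonneg (hlaw.nonneg y)]
  have hsum : Summable fun j => ∑ y : ArbPos F → K,
      μ.real {ω | (fun s : ArbPos F => M ω s.1.1 s.1.2) = y} *
        |corankMass (condLaw μ M F y) n j - altParity (Fintype.card K) n j| :=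
    summable_sum fun y _ => (hs y).mul_left _
  have key : ∑' j, |massFn μ (fun ω => corank (M ω)) j - altParity (Fintype.card K) n j| ≤
      2 * B := by
    refine ((Summable.of_nonneg_of_le (fun j => abs_nonneg _) hle hsum).tsum_le_tsum
      hle hsum).trans ?_
    rw [Summable.tsum_finsetSum fun y _ => (hs y).mul_left _]
    calc _ ≤ ∑ y : ArbPos F → K,
          μ.real {ω | (fun s : ArbPos F => M ω s.1.1 s.1.2) = y} * (2 * B) := by
          refine Finset.sum_le_sum fun y _ => ?_
          rw [tsum_mul_left]
          exact mul_le_mul_of_nonneg_left (hB y) (hlaw.nonneg y)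
      _ = 2 * B := by rw [← Finset.sum_mul, hlaw.sum_eq_one, one_mul]
  rw [tvDist]
  linarith

theorem tvDist_massFn_corank_le_one [MeasurableSingletonClass K] {C : ℝ}
    (hM : IsNearUniformAlternating C F μ M) [IsProbabilityMeasure μ] :
    tvDist (massFn μ fun ω => corank (M ω)) (altParity (Fintype.card K) n) ≤ 1 :=
  tvDist_massFn_corank_le hM fun y => by
    simpa using tsum_abs_corankMass_sub_le_two (isLaw_condLaw hM y) n

theorem tvDist_massFn_corank_le_pow [MeasurableSingletonClass K] {C α u : ℝ} (hC : 1 ≤ C)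
    (hα : α ≤ 1 / 100) (hF : SmallSymmetric α F) (hM : IsNearUniformAlternating C F μ M)
    [IsProbabilityMeasure μ] (hu : 100 * C ≤ u) (hq : (Fintype.card K : ℝ) = u ^ 200)
    (hn : 1 ≤ n) :
    tvDist (massFn μ fun ω => corank (M ω)) (altParity (Fintype.card K) n) ≤ (u⁻¹) ^ n := by
  refine tvDist_massFn_corank_le hM fun y => ?_
  -- The index sets are transported to natural numbers and left empty beyond `n`; `α ≤ 1 / 100`
  -- makes their size at most `n / 100`, rounded down.
  let N : ℕ → Finset ℕ := fun j => if h : j < n then (F ⟨j, h⟩).map Fin.valEmbedding else ∅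
  have hmem : ∀ i j, i ∈ N j ↔ ∃ (hi : i < n) (hj : j < n), (⟨i, hi⟩ : Fin n) ∈ F ⟨j, hj⟩ := by
    intro i j
    by_cases hj : j < n
    · simp only [N, dif_pos hj, Finset.mem_map, Fin.valEmbedding_apply]
      constructor
      · rintro ⟨x, hx, rfl⟩
        exact ⟨x.2, hj, hx⟩
      · rintro ⟨hi, _, h⟩
        exact ⟨_, h, rfl⟩
    · simp [N, hj]
  refine tsum_abs_corankMass_sub_le_pow (isLaw_condLaw hM y) hC hu hq (N := N) (b := n / 100)
    (fun i j => ?_) (fun i j _ hij a => ?_) (fun j => ?_) (Nat.mul_div_le n 100) hn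
  · rw [hmem, hmem]
    constructor
    · rintro ⟨hi, hj, h⟩
      exact ⟨hj, hi, (hF.symm _ _).1 h⟩
    · rintro ⟨hi, hj, h⟩
      exact ⟨hj, hi, (hF.symm _ _).1 h⟩
  · refine condLaw_le hC hM y i j (fun hi hj h => hij ?_) a
    exact (hmem i j).2 ⟨hi, hj, (hF.symm _ _).1 h⟩
  · by_cases hj : j < n
    · simp only [N, dif_pos hj, Finset.card_map]
      have h1 := hF.card_lt ⟨j, hj⟩
      have h2 : α * n ≤ 1 / 100 * n := by gcongr
      have h3 : ((F ⟨j, hj⟩).card * 100 : ℝ) ≤ n := by linarith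
      rw [Nat.le_div_iff_mul_le (by norm_num)]
      exact_mod_cast h3
    · simp [N, hj]

theorem inv_pow_le_div_pow_rpow {u B : ℝ} (hu : 0 ≤ u) (hB : 1 ≤ B) {m : ℕ} (hm : m ≠ 0)
    (n : ℕ) : (u⁻¹) ^ n ≤ (B / u ^ m) ^ (1 / (m : ℝ) * (n : ℝ)) := by
  have hm' : (m : ℝ) ≠ 0 := by exact_mod_cast hm
  calc u⁻¹ ^ n = ((u⁻¹) ^ m) ^ (1 / (m : ℝ) * (n : ℝ)) := by
        rw [← Real.rpow_natCast _ m, ← Real.rpow_mul (by positivity), ← Real.rpow_natCast,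
          ← mul_assoc, mul_one_div_cancel hm', one_mul]
    _ ≤ _ := by
        refine Real.rpow_le_rpow (by positivity) ?_ (by positivity)
        rw [inv_pow, ← one_div]
        gcongr

/-- If `n = 0` or `q ≤ (100 * C) ^ 200`, the right side is at least 1 and the trivial bound
suffices. Otherwise `u = q ^ (1 / 200)` satisfies `100 * C ≤ u`. -/
theorem tvDist_massFn_corank_le_rpow [MeasurableSingletonClass K] {C α : ℝ} (hC : 1 ≤ C)
    (hα : α ≤ 1 / 100) (hF : SmallSymmetric α F) (hM : IsNearUniformAlternating C F μ M)
    [IsProbabilityMeasure μ] :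
    tvDist (massFn μ fun ω => corank (M ω)) (altParity (Fintype.card K) n) ≤
      ((100 * C) ^ 200 / (Fintype.card K : ℝ)) ^ (1 / 200 * (n : ℝ)) := by
  have hq0 : (0 : ℝ) < Fintype.card K := by exact_mod_cast Fintype.card_pos (α := K)
  have hC1 : 1 ≤ 100 * C := by linarith
  rcases Nat.eq_zero_or_pos n with hn | hn
  · refine (tvDist_massFn_corank_le_one hM).trans_eq ?_
    rw [hn, Nat.cast_zero, mul_zero, Real.rpow_zero]
  rcases le_or_gt (Fintype.card K : ℝ) ((100 * C) ^ 200) with hle | hlt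
  · refine (tvDist_massFn_corank_le_one hM).trans (Real.one_le_rpow ?_ (by positivity))
    rwa [le_div_iff₀ hq0, one_mul]
  obtain ⟨u, hu⟩ : ∃ u : ℝ, u = (Fintype.card K : ℝ) ^ (1 / 200 : ℝ) := ⟨_, rfl⟩
  have hu0 : 0 ≤ u := by rw [hu]; positivity
  have hq : (Fintype.card K : ℝ) = u ^ 200 := by
    rw [hu, ← Real.rpow_natCast, ← Real.rpow_mul hq0.le]
    norm_num
  have hlt' : (100 * C) ^ 200 < u ^ 200 := by rwa [← hq]
  have hCu : 100 * C ≤ u := (lt_of_pow_lt_pow_left₀ 200 hu0 hlt').le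
  refine (tvDist_massFn_corank_le_pow hC hα hF hM hCu hq hn).trans ?_
  rw [hq]
  exact_mod_cast inv_pow_le_div_pow_rpow hu0 (one_le_pow₀ (n := 200) hC1) (by norm_num) n

end CondLaw

/-! ### The two parities and the final statement. -/

theorem altEven_eq_altParity {q n : ℕ} (hn : Even n) : altEven q = altParity q n := by
  ext j
  simp [altEven, altParity, Nat.even_add, hn]

theorem altOdd_eq_altParity {q n : ℕ} (hn : Odd n) : altOdd q = altParity q n := by
  ext j
  simp [altOdd, altParity, Nat.even_add, Nat.not_even_iff_odd.2 hn]

theorem theorem1p6 :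
    ∃ α₀ : ℝ, 0 < α₀ ∧ ∀ C : ℝ, 1 ≤ C → ∃ c C' : ℝ, 0 < c ∧ 0 < C' ∧
      ∀ (α : ℝ), 0 < α → α ≤ α₀ →
      ∀ (K : Type*) [Field K] [Fintype K] [MeasurableSpace K] [MeasurableSingletonClass K],
        Odd (Fintype.card K) →
      ∀ (n : ℕ) (F : Fin n → Finset (Fin n)), SmallSymmetric α F →
      ∀ (Ω : Type*) [MeasurableSpace Ω] (μ : Measure Ω) [IsProbabilityMeasure μ]
        (M : Ω → Matrix (Fin n) (Fin n) K), IsNearUniformAlternating C F μ M →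
        (Even n →
          tvDist (massFn μ fun ω => corank (M ω)) (altEven (Fintype.card K)) ≤
            (C' / (Fintype.card K : ℝ)) ^ (c * (n : ℝ))) ∧
        (Odd n →
          tvDist (massFn μ fun ω => corank (M ω)) (altOdd (Fintype.card K)) ≤
            (C' / (Fintype.card K : ℝ)) ^ (c * (n : ℝ))) := by
  refine ⟨1 / 100, by norm_num, fun C hC => ⟨1 / 200, (100 * C) ^ 200, by norm_num,
    pow_pos (by linarith) 200, ?_⟩⟩
  intro α _ hα K _ _ _ _ _ n F hF Ω _ μ _ M hM
  refine ⟨fun hn => ?_, fun hn => ?_⟩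
  · rw [altEven_eq_altParity hn]
    exact tvDist_massFn_corank_le_rpow hC hα hF hM
  · rw [altOdd_eq_altParity hn]
    exact tvDist_massFn_corank_le_rpow hC hα hF hM
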